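/- Let $r \ge 2$ and $m, t \ge 1$ be integers. *Rings.* Let $\mathbb{L}_r$ be the ring with generators $x_1,\dots,x_r,y_1,\dots,y_r$ and relations $x_i y_j = \delta_{i,j}$ (for all $i,j$) and $\sum_{i=1}^r y_i x_i = 1$, with the involution $p \mapsto p^*$ that is the anti-automorphism interchanging $x_i$ and $y_i$, and whose positive cone is the additive monoid generated by all monomials in the $x_i$ and $y_i$. Let $\mathbb{L}_r^{\otimes t}$ be the tensor product over $\mathbb{Z}$ of $t$ copies of $\mathbb{L}_r$, with the factorwise involution, and whose positive cone is the additive monoid generated by the tensors $p_1 \otimes \cdots \otimes p_t$ with all $p_\ell$ in the positive cone of $\mathbb{L}_r$. Let $U \mapsto U^*$ denote the conjugate transpose of matrices. For $R = \mathbb{L}_r$ or $R = \mathbb{L}_r^{\otimes t}$, let $\mathrm{PU}_m(R)$ be the group of all $m \times m$ matrices $U$ over $R$ with $UU^* = U^*U = \mathbf{I}_m$ that lie in the positive cone of $\mathrm{Mat}_m(R)$, that is, in the additive monoid generated by the products of a matrix unit and an element of the positive cone of $R$. *Groups.* For $1 \le \ell \le t$, $1 \le k \le r$ let $y_{\ell,k}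 = 1^{\otimes(\ell-1)} \otimes y_k \otimes 1^{\otimes(t-\ell)}$. Consider the words $e_{i,1} b_1 \cdots b_t$, where $1 \le i \le m$ and $b_\ell$ is an element of the free monoid on $y_{\ell,1},\dots,y_{\ell,r}$; each has a value in $\mathrm{Mat}_m(\mathbb{L}_r^{\otimes t})$, where $e_{i,1}$ is the $m\times m$ matrix unit. For a finite set $A$ of words, $a \in A$ and $1 \le \ell \le t$, let $\partial_{\ell,a}(A) = (A \setminus \{a\}) \cup \{a y_{\ell,1}, \dots, a y_{\ell,r}\}$. The *bases* are the members of the smallest family of sets of words that contains $\{e_{1,1},\dots,e_{m,1}\}$ and contains $\partial_{\ell,a}(A)$ whenever it contains $A$ and $a \in A$. For a bijection $\phi\colon A \to B$, $a \mapsto a^\phi$, between bases, the expansion $\partial_{\ell,a}(\phi)\colon \partial_{\ell,a}(A) \to \partial_{\ell,a^\phi}(B)$ agrees with $\phi$ on $A \setminus \{a\}$ and sends $a y_{\ell,k}$ to $a^\phi y_{\ell,k}$ for each $k$. The *Brin–Higman–Thompson group* $tV_{r,m}$ is the set of bijections between bases modulo the equivalence relation generated by identifying each bijection with its expansions; the product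 of the classes of $\phi\colon A \to B$ and $\psi\colon B \to C$ is the class of $\phi$ followed by $\psi$ (any two classes have such representatives, and the product is well defined). The *Higman–Thompson group* is $V_{r,m} = 1V_{r,m}$. **Theorem.** There is a group isomorphism $tV_{r,m} \to \mathrm{PU}_m(\mathbb{L}_r^{\otimes t})$ that sends, for every bijection $\phi\colon A \to B$ between bases, the class of $\phi$ to $\sum_{a \in A} a \cdot (a^\phi)^*$. In particular, in the case $t=1$, the same formula, with words evaluated in $\mathrm{Mat}_m(\mathbb{L}_r)$, gives an isomorphism $V_{r,m} \to \mathrm{PU}_m(\mathbb{L}_r)$. -/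

import Mathlib

/-! ### The Leavitt ring and its involution -/

/-- The defining relations of the Leavitt ring, on free generators `x i = ι (inl i)` and
`y i = ι (inr i)`: `x i * y j = δ i j` and `∑ i, y i * x i = 1`. -/
inductive LeavittRel (r : ℕ) :
    FreeAlgebra ℤ (Fin r ⊕ Fin r) → FreeAlgebra ℤ (Fin r ⊕ Fin r) → Prop
  | xy (i j : Fin r) : LeavittRel r
      (FreeAlgebra.ι ℤ (Sum.inl i) * FreeAlgebra.ι ℤ (Sum.inr j)) (if i = j then 1 else 0)
  | yx : LeavittRel r
      (∑ i : Fin r, FreeAlgebra.ι ℤ (Sum.inr i) * FreeAlgebra.ι ℤ (Sum.inl i)) 1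

/-- The Leavitt ring `L_r` over `ℤ`. -/
def Leavitt (r : ℕ) : Type := RingQuot (LeavittRel r)

noncomputable section

namespace Leavitt

variable {r : ℕ}

instance : Ring (Leavitt r) := inferInstanceAs (Ring (RingQuot (LeavittRel r)))

/-- The quotient map from the free ring. -/
def proj (r : ℕ) : FreeAlgebra ℤ (Fin r ⊕ Fin r) →+* Leavitt r := RingQuot.mkRingHom (LeavittRel r)

/-- The generator `x i`. -/
def x (i : Fin r) : Leavitt r := proj r (FreeAlgebra.ι ℤ (Sum.inl i))

/-- The generator `y i`. -/
def y (i : Fin r) : Leavitt r := proj r (FreeAlgebra.ι ℤ (Sum.inr i))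

theorem x_mul_y (i j : Fin r) : x i * y j = if i = j then 1 else 0 := by
  have h := RingQuot.mkRingHom_rel (LeavittRel.xy i j)
  change proj r _ = proj r _ at h
  rw [map_mul] at h
  rw [x, y, h]
  split_ifs <;> simp

theorem sum_y_mul_x : ∑ i : Fin r, y i * x i = 1 := by
  have h := RingQuot.mkRingHom_rel (LeavittRel.yx (r := r))
  change proj r _ = proj r _ at h
  simpa [map_sum, x, y] using h

/-- Ring homomorphisms out of `L_r` are determined by the images of the generators. -/
theorem hom_ext {S : Type*} [Ring S] {f g : Leavitt r →+* S} (hx : ∀ i, f (x i) = g (x i))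
    (hy : ∀ i, f (y i) = g (y i)) : f = g := by
  refine RingQuot.ringQuot_ext f g ?_
  have : ((f.comp (proj r)).toIntAlgHom) = (g.comp (proj r)).toIntAlgHom := by
    apply FreeAlgebra.hom_ext
    funext s
    rcases s with i | i
    · exact hx i
    · exact hy i
  ext a
  exact DFunLike.congr_fun this a

/-- The anti-endomorphism of `L_r` which interchanges `x i` and `y i`, as a homomorphism to the
opposite ring. -/
def starHom (r : ℕ) : Leavitt r →+* (Leavitt r)ᵐᵒᵖ :=
  RingQuot.lift ⟨((FreeAlgebra.lift ℤ (Sum.elim (fun i => MulOpposite.op (y i))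
    (fun i => MulOpposite.op (x i))) : FreeAlgebra ℤ (Fin r ⊕ Fin r) →ₐ[ℤ] (Leavitt r)ᵐᵒᵖ) :
      FreeAlgebra ℤ (Fin r ⊕ Fin r) →+* (Leavitt r)ᵐᵒᵖ), by
    intro a b h
    cases h with
    | xy i j =>
      simp only [RingHom.coe_coe, map_mul, FreeAlgebra.lift_ι_apply, Sum.elim_inl, Sum.elim_inr,
        ← MulOpposite.op_mul, x_mul_y]
      by_cases hij : i = j
      · subst hij; simp
      · simp [hij, Ne.symm hij]
    | yx =>
      simp only [RingHom.coe_coe, map_sum, map_mul, FreeAlgebra.lift_ι_apply, Sum.elim_inl,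
        Sum.elim_inr, ← MulOpposite.op_mul, map_one]
      rw [← Finset.op_sum, sum_y_mul_x, MulOpposite.op_one]⟩

theorem starHom_x (i : Fin r) : starHom r (x i) = MulOpposite.op (y i) := by
  simp only [starHom, x, proj]
  erw [RingQuot.lift_mkRingHom_apply]
  simp

theorem starHom_y (i : Fin r) : starHom r (y i) = MulOpposite.op (x i) := by
  simp only [starHom, y, proj]
  erw [RingQuot.lift_mkRingHom_apply]
  simp

theorem starHom_starHom (a : Leavitt r) : (starHom r (starHom r a).unop).unop = a := by
  let g : Leavitt r →+* Leavitt r :=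
    { toFun := fun a => (starHom r (starHom r a).unop).unop
      map_one' := by simp
      map_zero' := by simp
      map_mul' := by simp
      map_add' := by simp }
  have : g = RingHom.id _ := hom_ext
    (fun i => by change (starHom r (starHom r (x i)).unop).unop = x i; simp [starHom_x, starHom_y])
    (fun i => by change (starHom r (starHom r (y i)).unop).unop = y i; simp [starHom_x, starHom_y])
  exact DFunLike.congr_fun this a

/-- The involution of `L_r`: the anti-automorphism interchanging `x i` and `y i`. -/
instance : StarRing (Leavitt r) where
  star a := (starHom r a).unop
  star_involutive := starHom_starHom
  star_mul a b := by simp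
  star_add a b := by simp

@[simp] theorem star_x (i : Fin r) : star (x i) = y i := by
  change (starHom r (x i)).unop = _
  rw [starHom_x, MulOpposite.unop_op]

@[simp] theorem star_y (i : Fin r) : star (y i) = x i := by
  change (starHom r (y i)).unop = _
  rw [starHom_y, MulOpposite.unop_op]

/-- The multiplicative monoid of monomials in the generators `x i`, `y i`. -/
def monomials (r : ℕ) : Submonoid (Leavitt r) := Submonoid.closure (Set.range x ∪ Set.range y)

theorem star_mem_monomials {a : Leavitt r} (ha : a ∈ monomials r) : star a ∈ monomials r := by
  induction ha using Submonoid.closure_induction with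
  | mem a h =>
    rcases h with ⟨i, rfl⟩ | ⟨i, rfl⟩
    · rw [star_x]; exact Submonoid.subset_closure (Or.inr ⟨i, rfl⟩)
    · rw [star_y]; exact Submonoid.subset_closure (Or.inl ⟨i, rfl⟩)
  | one => rw [star_one]; exact one_mem _
  | mul a b _ _ ha hb => rw [star_mul]; exact mul_mem hb ha

/-- The positive cone of `L_r`: the additive monoid generated by the monomials. It is closed under
multiplication and the involution. -/
def cone (r : ℕ) : StarSubsemiring (Leavitt r) where
  toSubsemiring := (monomials r).subsemiringClosure
  star_mem' := by
    intro a ha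
    change star a ∈ (monomials r).subsemiringClosure
    replace ha : a ∈ (monomials r).subsemiringClosure := ha
    rw [Submonoid.subsemiringClosure_mem] at ha ⊢
    induction ha using AddSubmonoid.closure_induction with
    | mem a h => exact AddSubmonoid.subset_closure (star_mem_monomials h)
    | zero => rw [star_zero]; exact zero_mem _
    | add a b _ _ ha hb => rw [star_add]; exact add_mem ha hb

end Leavitt

/-! ### Tensor powers of the Leavitt ring -/

open scoped TensorProduct in
/-- The ring `L_r^{⊗ t}`, the tensor product over `ℤ` of `t` copies of `L_r`. -/
abbrev LeavittTensor (r t : ℕ) : Type := ⨂[ℤ] _ : Fin t, Leavitt r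

namespace LeavittTensor

variable {r t : ℕ}

/-- The additive map `p₁ ⊗ ⋯ ⊗ p_t ↦ p₁^* ⊗ ⋯ ⊗ p_t^*`. -/
def starMap (r t : ℕ) : LeavittTensor r t →ₗ[ℤ] LeavittTensor r t :=
  PiTensorProduct.map fun _ : Fin t =>
    ((starAddEquiv : Leavitt r ≃+ Leavitt r) : Leavitt r →+ Leavitt r).toIntLinearMap

theorem starMap_tprod (p : Fin t → Leavitt r) :
    starMap r t (PiTensorProduct.tprod ℤ p) = PiTensorProduct.tprod ℤ (fun ℓ => star (p ℓ)) := by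
  simp [starMap, PiTensorProduct.map_tprod]

/-- The involution of `L_r^{⊗ t}` which extends the involutions of the factors. -/
instance : StarRing (LeavittTensor r t) where
  star := starMap r t
  star_involutive a := by
    induction a using PiTensorProduct.induction_on with
    | smul_tprod n p => simp only [map_smul, starMap_tprod, star_star]
    | add a b ha hb => rw [map_add, map_add, ha, hb]
  star_mul a b := by
    change starMap r t (a * b) = starMap r t b * starMap r t a
    induction a using PiTensorProduct.induction_on with
    | smul_tprod n p =>
      induction b using PiTensorProduct.induction_on with
      | smul_tprod k q =>
        simp only [map_smul, starMap_tprod, PiTensorProduct.smul_tprod_mul_smul_tprod]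
        rw [mul_comm]
        congr 2
        funext ℓ
        simp
      | add a b ha hb => rw [mul_add, map_add, map_add, add_mul, ha, hb]
    | add a b ha hb => rw [add_mul, map_add, map_add, mul_add, ha, hb]
  star_add a b := map_add (starMap r t) a b

@[simp] theorem star_tprod (p : Fin t → Leavitt r) :
    star (PiTensorProduct.tprod ℤ p : LeavittTensor r t) =
      PiTensorProduct.tprod ℤ (fun ℓ => star (p ℓ)) := starMap_tprod p

/-- The element `y_{ℓ,k} = 1 ⊗ ⋯ ⊗ y_k ⊗ ⋯ ⊗ 1`, with `y_k` in position `ℓ`. -/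
def y (ℓ : Fin t) (k : Fin r) : LeavittTensor r t :=
  PiTensorProduct.tprod ℤ (Function.update (1 : Fin t → Leavitt r) ℓ (Leavitt.y k))

/-- The pure tensors `p₁ ⊗ ⋯ ⊗ p_t` with all `p_ℓ` in the positive cone of `L_r`. -/
def positiveTensors (r t : ℕ) : Submonoid (LeavittTensor r t) where
  carrier := {a | ∃ p : Fin t → Leavitt r, (∀ ℓ, p ℓ ∈ Leavitt.cone r) ∧
    a = PiTensorProduct.tprod ℤ p}
  one_mem' := ⟨1, fun _ => one_mem (Leavitt.cone r), rfl⟩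
  mul_mem' := by
    rintro _ _ ⟨p, hp, rfl⟩ ⟨q, hq, rfl⟩
    exact ⟨p * q, fun ℓ => mul_mem (hp ℓ) (hq ℓ), PiTensorProduct.tprod_mul_tprod p q⟩

/-- The positive cone of `L_r^{⊗ t}`: the additive monoid generated by the products of the positive
cones of the factors. -/
def cone (r t : ℕ) : StarSubsemiring (LeavittTensor r t) where
  toSubsemiring := (positiveTensors r t).subsemiringClosure
  star_mem' := by
    intro a ha
    change star a ∈ (positiveTensors r t).subsemiringClosure
    replace ha : a ∈ (positiveTensors r t).subsemiringClosure := ha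
    rw [Submonoid.subsemiringClosure_mem] at ha ⊢
    induction ha using AddSubmonoid.closure_induction with
    | mem a h =>
      obtain ⟨p, hp, rfl⟩ := h
      exact AddSubmonoid.subset_closure
        ⟨fun ℓ => star (p ℓ), fun ℓ => star_mem (hp ℓ), star_tprod p⟩
    | zero => rw [star_zero]; exact zero_mem _
    | add a b _ _ ha hb => rw [star_add]; exact add_mem ha hb

end LeavittTensor

/-! ### Positive unitary matrices -/

section PositiveUnitary

variable {R : Type*} [Ring R] [StarRing R]

/-- The positive cone of `Mat_m(R) = Mat_m(ℤ) ⊗ R`, where `P` is the positive cone of `R`: the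
additive monoid generated by the products `U ⊗ p`, where `U` lies in the positive cone of
`Mat_m(ℤ)`, the additive monoid generated by the matrix units, and `p` lies in `P`. -/
def matrixCone (m : ℕ) (P : StarSubsemiring R) : AddSubmonoid (Matrix (Fin m) (Fin m) R) :=
  AddSubmonoid.closure {M | ∃ U ∈ AddSubmonoid.closure
      {U : Matrix (Fin m) (Fin m) ℤ | ∃ i j, U = Matrix.single i j 1},
    ∃ p ∈ P, M = Matrix.of fun i j => U i j • p}

/-- A matrix is positive if and only if all its entries are. -/
theorem mem_matrixCone {m : ℕ} {P : StarSubsemiring R} {M : Matrix (Fin m) (Fin m) R} :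
    M ∈ matrixCone m P ↔ ∀ i j, M i j ∈ P := by
  constructor
  · intro h
    induction h using AddSubmonoid.closure_induction with
    | mem M h =>
      obtain ⟨U, hU, p, hp, rfl⟩ := h
      intro i j
      have hU' : 0 ≤ U i j := by
        induction hU using AddSubmonoid.closure_induction with
        | mem U h =>
          obtain ⟨k, l, rfl⟩ := h
          rw [Matrix.single_apply]
          split_ifs <;> simp
        | zero => simp
        | add U V _ _ hU hV => exact add_nonneg hU hV
      obtain ⟨n, hn⟩ := Int.eq_ofNat_of_zero_le hU'
      rw [Matrix.of_apply, hn, natCast_zsmul]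
      exact nsmul_mem hp n
    | zero => intro i j; exact zero_mem P
    | add M N _ _ hM hN => intro i j; exact add_mem (hM i j) (hN i j)
  · intro h
    rw [Matrix.matrix_eq_sum_single M]
    refine sum_mem fun i _ => sum_mem fun j _ => AddSubmonoid.subset_closure
      ⟨Matrix.single i j 1, AddSubmonoid.subset_closure ⟨i, j, rfl⟩, M i j, h i j, ?_⟩
    ext k l
    rw [Matrix.of_apply, Matrix.single_apply, Matrix.single_apply]
    split_ifs <;> simp

/-- The group of positive unitary `m × m` matrices over `R`, where `P` is the positive cone of `R`:
the matrices `u` in the positive cone with `u * u^* = u^* * u = 1`, where `u^*` is the conjugate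
transpose. -/
def PU (m : ℕ) (P : StarSubsemiring R) : Subgroup (unitary (Matrix (Fin m) (Fin m) R)) where
  carrier := {u | (u : Matrix (Fin m) (Fin m) R) ∈ matrixCone m P}
  one_mem' := by
    change (1 : Matrix (Fin m) (Fin m) R) ∈ matrixCone m P
    rw [mem_matrixCone]
    intro i j
    rw [Matrix.one_apply]
    split_ifs
    · exact one_mem P
    · exact zero_mem P
  mul_mem' := by
    intro u v hu hv
    change (u : Matrix (Fin m) (Fin m) R) * v ∈ matrixCone m P
    replace hu := mem_matrixCone.1 hu
    replace hv := mem_matrixCone.1 hv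
    rw [mem_matrixCone]
    intro i j
    rw [Matrix.mul_apply]
    exact sum_mem fun k _ => mul_mem (hu i k) (hv k j)
  inv_mem' := by
    intro u hu
    change star (u : Matrix (Fin m) (Fin m) R) ∈ matrixCone m P
    replace hu := mem_matrixCone.1 hu
    rw [mem_matrixCone]
    intro i j
    exact star_mem (hu j i)

end PositiveUnitary

/-! ### Words, bases and the Brin-Higman-Thompson group -/

section BrinHigmanThompson

/-- The words `e_{i,1} b_1 ⋯ b_t`, where `b_ℓ` is a word in `y_{ℓ,1}, …, y_{ℓ,r}`: letters with
different first indices commute, and letters with the same first index are free. -/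
abbrev BHTWord (r m t : ℕ) : Type := Fin m × (Fin t → List (Fin r))

namespace BHTWord

variable {r m t : ℕ}

/-- The word `e_{i,1}`. -/
def root (i : Fin m) : BHTWord r m t := (i, fun _ => [])

/-- The word `a y_{ℓ,s}`. -/
def child (a : BHTWord r m t) (ℓ : Fin t) (s : Fin r) : BHTWord r m t :=
  (a.1, Function.update a.2 ℓ (a.2 ℓ ++ [s]))

/-- The word `a = e_{i,1} b_1 ⋯ b_t` as an element of `Mat_m(R)`, where the letter `y_{ℓ,k}` is
given the value `y ℓ k`. -/
def toMatrix {R : Type*} [Ring R] [NeZero m] (y : Fin t → Fin r → R) (a : BHTWord r m t) :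
    Matrix (Fin m) (Fin m) R :=
  Matrix.single a.1 0 (List.ofFn fun ℓ => ((a.2 ℓ).map (y ℓ)).prod).prod

/-- The expansion `∂_{ℓ,a}(A)`, the set `A ∖ {a} ∪ {a y_{ℓ,1}, …, a y_{ℓ,r}}`. -/
def expand (A : Finset (BHTWord r m t)) (ℓ : Fin t) (a : BHTWord r m t) :
    Finset (BHTWord r m t) :=
  A.erase a ∪ Finset.univ.image (child a ℓ)

/-- The smallest set of sets of words which contains `{e_{1,1}, …, e_{m,1}}` and is closed under
expansions. -/
inductive IsBasis : Finset (BHTWord r m t) → Prop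
  | root : IsBasis (Finset.univ.image root)
  | expand {A : Finset (BHTWord r m t)} (hA : IsBasis A) (ℓ : Fin t) {a : BHTWord r m t}
      (ha : a ∈ A) : IsBasis (expand A ℓ a)

/-- Tuples of infinite words. -/
abbrev Tail (r t : ℕ) : Type := Fin t → Stream' (Fin r)

/-- Infinite words `e_{i,1} β_1 ⋯ β_t`. -/
abbrev Inf (r m t : ℕ) : Type := Fin m × Tail r t

/-- The infinite word `a β`. -/
def app (a : BHTWord r m t) (f : Tail r t) : Inf r m t := (a.1, fun ℓ => a.2 ℓ ++ₛ f ℓ)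

/-- The tuple `y_{ℓ,s} β`. -/
def consTail (ℓ : Fin t) (s : Fin r) (f : Tail r t) : Tail r t :=
  Function.update f ℓ (Stream'.cons s (f ℓ))

theorem app_child (a : BHTWord r m t) (ℓ : Fin t) (s : Fin r) (f : Tail r t) :
    app (child a ℓ s) f = app a (consTail ℓ s f) := by
  refine Prod.ext rfl (funext fun k => ?_)
  by_cases hk : k = ℓ
  · subst hk
    simp [app, child, consTail, Stream'.append_append_stream, Stream'.cons_append_stream]
  · simp [app, child, consTail, hk]

theorem exists_consTail (ℓ : Fin t) (f : Tail r t) : ∃ s g, f = consTail ℓ s g := by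
  refine ⟨(f ℓ).head, Function.update f ℓ (f ℓ).tail, funext fun k => ?_⟩
  by_cases hk : k = ℓ
  · subst hk
    simp [consTail, Stream'.eta]
  · simp [consTail, hk]

theorem consTail_inj {ℓ : Fin t} {s s' : Fin r} {f g : Tail r t}
    (h : consTail ℓ s f = consTail ℓ s' g) : s = s' ∧ f = g := by
  have h1 : Stream'.cons s (f ℓ) = Stream'.cons s' (g ℓ) := by
    simpa [consTail] using congrFun h ℓ
  obtain ⟨h2, h3⟩ := Stream'.cons_injective2 h1
  refine ⟨h2, funext fun k => ?_⟩
  by_cases hk : k = ℓ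
  · subst hk; exact h3
  · simpa [consTail, hk] using congrFun h k

theorem app_right_injective {a : BHTWord r m t} {f g : Tail r t} (h : app a f = app a g) :
    f = g :=
  funext fun ℓ => Stream'.append_right_injective _ _ _ (congrFun (congrArg Prod.snd h) ℓ)

theorem mem_expand {A : Finset (BHTWord r m t)} {ℓ : Fin t} {a b : BHTWord r m t} :
    b ∈ expand A ℓ a ↔ (b ≠ a ∧ b ∈ A) ∨ ∃ s, child a ℓ s = b := by
  simp [expand]

/-- Every infinite word has exactly one prefix in a given basis. -/
theorem IsBasis.existsUnique {A : Finset (BHTWord r m t)} (hA : IsBasis A) (ν : Inf r m t) :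
    ∃! p : A × Tail r t, app (p.1 : BHTWord r m t) p.2 = ν := by
  induction hA generalizing ν with
  | root =>
    refine ⟨(⟨BHTWord.root ν.1, by simp⟩, ν.2), rfl, ?_⟩
    rintro ⟨⟨a, ha⟩, f⟩ h
    obtain ⟨i, -, rfl⟩ := Finset.mem_image.1 ha
    subst h
    rfl
  | expand hA ℓ ha ih =>
    rename_i A a
    obtain ⟨⟨⟨b, hb⟩, f⟩, h, hu⟩ := ih ν
    have key : ∀ c (hc : c ∈ A) g, app c g = ν → c = b ∧ g = f := by
      intro c hc g hg
      have := hu (⟨c, hc⟩, g) hg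
      simpa [Prod.ext_iff] using this
    by_cases hba : b = a
    · subst hba
      obtain ⟨s, g, rfl⟩ := exists_consTail ℓ f
      refine ⟨(⟨child b ℓ s, mem_expand.2 (Or.inr ⟨s, rfl⟩)⟩, g), ?_, ?_⟩
      · exact (app_child b ℓ s g).trans h
      · rintro ⟨⟨c, hc⟩, g'⟩ hg'
        rcases mem_expand.1 hc with ⟨hcb, hcA⟩ | ⟨s', rfl⟩
        · exact absurd (key c hcA g' hg').1 hcb
        · have := (key b hb (consTail ℓ s' g') ((app_child b ℓ s' g').symm.trans hg')).2
          obtain ⟨rfl, rfl⟩ := consTail_inj this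
          rfl
    · refine ⟨(⟨b, mem_expand.2 (Or.inl ⟨hba, hb⟩)⟩, f), h, ?_⟩
      rintro ⟨⟨c, hc⟩, g⟩ hg
      rcases mem_expand.1 hc with ⟨hca, hcA⟩ | ⟨s', rfl⟩
      · obtain ⟨rfl, rfl⟩ := key c hcA g hg
        rfl
      · exact absurd (key a ha (consTail ℓ s' g) ((app_child a ℓ s' g).symm.trans hg)).1.symm hba

/-- Infinite words are the words in a basis followed by infinite tails. -/
def IsBasis.decomp {A : Finset (BHTWord r m t)} (hA : IsBasis A) : A × Tail r t ≃ Inf r m t :=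
  Equiv.ofBijective (fun p => app (p.1 : BHTWord r m t) p.2)
    (Function.bijective_iff_existsUnique _ |>.2 hA.existsUnique)

theorem IsBasis.decomp_symm_app {A : Finset (BHTWord r m t)} (hA : IsBasis A)
    {a : BHTWord r m t} (ha : a ∈ A) (f : Tail r t) :
    hA.decomp.symm (app a f) = (⟨a, ha⟩, f) :=
  hA.decomp.symm_apply_apply (⟨a, ha⟩, f)

theorem IsBasis.eq_of_app {A : Finset (BHTWord r m t)} (hA : IsBasis A)
    {a b : BHTWord r m t} (ha : a ∈ A) (hb : b ∈ A) {f g : Tail r t} (h : app a f = app b g) :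
    a = b := by
  have h1 := hA.decomp_symm_app ha f
  rw [h, hA.decomp_symm_app hb g] at h1
  exact (congrArg (fun p => (p.1 : BHTWord r m t)) h1).symm

theorem child_ne (a : BHTWord r m t) (ℓ : Fin t) (s : Fin r) : child a ℓ s ≠ a := by
  intro h
  have := congrArg List.length (congrFun (congrArg Prod.snd h) ℓ)
  simp [child] at this

theorem child_injective (a : BHTWord r m t) (ℓ : Fin t) : Function.Injective (child a ℓ) := by
  intro s s' h
  have := congrFun (congrArg Prod.snd h) ℓ
  simpa [child] using this

/-- A child of an element of a basis does not lie in the basis. -/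
theorem IsBasis.child_notMem [NeZero r] {A : Finset (BHTWord r m t)} (hA : IsBasis A)
    {a : BHTWord r m t} (ha : a ∈ A) (ℓ : Fin t) (s : Fin r) : child a ℓ s ∉ A := by
  intro h
  exact child_ne a ℓ s
    (hA.eq_of_app h ha (app_child a ℓ s (fun _ => Stream'.const 0)))

/-- The multi-homogeneous set of all words with all `ℓ`-lengths equal to `n`. -/
def level (r m t n : ℕ) : Set (BHTWord r m t) := {a | ∀ ℓ, (a.2 ℓ).length = n}

/-- A basis contained in a multi-homogeneous set is all of it. -/
theorem IsBasis.mem_of_level [NeZero r] {A : Finset (BHTWord r m t)} (hA : IsBasis A) {n : ℕ}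
    (h : ∀ a ∈ A, a ∈ level r m t n) (b : BHTWord r m t) : b ∈ A ↔ b ∈ level r m t n := by
  refine ⟨h b, fun hb => ?_⟩
  obtain ⟨⟨⟨a, ha⟩, f⟩, hf, -⟩ := hA.existsUnique (app b fun _ => Stream'.const 0)
  have : a = b := by
    refine Prod.ext (congrArg (fun p : Inf r m t => p.1) hf :) (funext fun ℓ => ?_)
    exact Stream'.append_left_injective _ _ _ _ (congrFun (congrArg Prod.snd hf) ℓ)
      ((h a ha ℓ).trans (hb ℓ).symm)
  exact this ▸ ha

end BHTWord

open BHTWord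

/-- A bijection `φ : A → B` between bases. -/
structure BasisBij (r m t : ℕ) where
  /-- The domain `A`. -/
  dom : Finset (BHTWord r m t)
  /-- The codomain `B`. -/
  cod : Finset (BHTWord r m t)
  dom_basis : IsBasis dom
  cod_basis : IsBasis cod
  /-- The bijection. -/
  map : dom ≃ cod

namespace BasisBij

variable {r m t : ℕ}

/-- `ψ` is an expansion `∂_{ℓ,a}(φ)` of `φ`, where `a ∈ A` and `b = a^φ`: `ψ` is the bijection
`∂_{ℓ,a}(A) → ∂_{ℓ,b}(B)` which acts as `φ` on `A ∖ {a}` and sends `a y_{ℓ,s}` to `b y_{ℓ,s}` for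
each `s`. -/
def IsExpansion (φ ψ : BasisBij r m t) : Prop :=
  ∃ (ℓ : Fin t) (a : φ.dom),
    ψ.dom = expand φ.dom ℓ a ∧ ψ.cod = expand φ.cod ℓ (φ.map a) ∧
    (∀ (c : φ.dom) (c' : ψ.dom), c ≠ a → (c' : BHTWord r m t) = c →
      (ψ.map c' : BHTWord r m t) = φ.map c) ∧
    (∀ (s : Fin r) (c' : ψ.dom), (c' : BHTWord r m t) = child a ℓ s →
      (ψ.map c' : BHTWord r m t) = child (φ.map a) ℓ s)

/-- The smallest equivalence relation identifying each bijection with all of its expansions. -/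
def setoid (r m t : ℕ) : Setoid (BasisBij r m t) := Relation.EqvGen.setoid IsExpansion

/-- The inverse bijection. -/
def symm (φ : BasisBij r m t) : BasisBij r m t where
  dom := φ.cod
  cod := φ.dom
  dom_basis := φ.cod_basis
  cod_basis := φ.dom_basis
  map := φ.map.symm

/-- The identity on the basis `{e_{1,1}, …, e_{m,1}}`. -/
def refl (r m t : ℕ) : BasisBij r m t where
  dom := Finset.univ.image root
  cod := Finset.univ.image root
  dom_basis := IsBasis.root
  cod_basis := IsBasis.root
  map := Equiv.refl _

/-- The composition of `φ : A → B` and `ψ : B → C`, first `φ` and then `ψ`. -/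
def trans (φ ψ : BasisBij r m t) (h : φ.cod = ψ.dom) : BasisBij r m t where
  dom := φ.dom
  cod := ψ.cod
  dom_basis := φ.dom_basis
  cod_basis := ψ.cod_basis
  map := (φ.map.trans (Equiv.setCongr (congrArg _ h))).trans ψ.map

theorem ext' {φ ψ : BasisBij r m t} (hd : φ.dom = ψ.dom)
    (h : ∀ a (ha : a ∈ φ.dom) (ha' : a ∈ ψ.dom),
      (φ.map ⟨a, ha⟩ : BHTWord r m t) = ψ.map ⟨a, ha'⟩) : φ = ψ := by
  obtain ⟨A, B, hA, hB, e⟩ := φ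
  obtain ⟨A', B', hA', hB', e'⟩ := ψ
  dsimp only at hd h
  subst hd
  have hBB : B = B' := by
    ext b
    constructor
    · intro hb
      obtain ⟨a, ha⟩ := e.surjective ⟨b, hb⟩
      have := h a a.2 a.2
      rw [Subtype.coe_eta, ha] at this
      change b = (e' a : BHTWord r m t) at this
      exact this ▸ (e' a).2
    · intro hb
      obtain ⟨a, ha⟩ := e'.surjective ⟨b, hb⟩
      have := h a a.2 a.2
      rw [Subtype.coe_eta, ha] at this
      change (e a : BHTWord r m t) = b at this
      exact this ▸ (e a).2
  subst hBB
  have : e = e' := Equiv.ext fun a => Subtype.ext (h a a.2 a.2)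
  subst this
  rfl

theorem isExpansion_symm {φ ψ : BasisBij r m t} (h : IsExpansion φ ψ) :
    IsExpansion φ.symm ψ.symm := by
  obtain ⟨ℓ, a, h1, h2, h3, h4⟩ := h
  refine ⟨ℓ, φ.map a, h2, ?_, ?_, ?_⟩
  · change ψ.dom = expand φ.dom ℓ (φ.map.symm (φ.map a))
    rw [Equiv.symm_apply_apply, h1]
  · intro c c' hc hcc
    change ((ψ.map.symm c' : ψ.dom) : BHTWord r m t) = φ.map.symm c
    obtain ⟨d, rfl⟩ := φ.map.surjective c
    rw [Equiv.symm_apply_apply]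
    have hda : d ≠ a := fun h => hc (congrArg φ.map h)
    have hd : (d : BHTWord r m t) ∈ ψ.dom := by
      rw [h1]
      exact mem_expand.2 (Or.inl ⟨fun h => hda (Subtype.ext h), d.2⟩)
    have := h3 d ⟨d, hd⟩ hda rfl
    have hc' : c' = ψ.map ⟨d, hd⟩ := Subtype.ext (hcc.trans this.symm)
    rw [hc', Equiv.symm_apply_apply]
  · intro s c' hcc
    change ((ψ.map.symm c' : ψ.dom) : BHTWord r m t) = child (φ.map.symm (φ.map a)) ℓ s
    rw [Equiv.symm_apply_apply]
    have hd : child (a : BHTWord r m t) ℓ s ∈ ψ.dom := by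
      rw [h1]
      exact mem_expand.2 (Or.inr ⟨s, rfl⟩)
    have := h4 s ⟨_, hd⟩ rfl
    have hc' : c' = ψ.map ⟨_, hd⟩ := Subtype.ext (hcc.trans this.symm)
    rw [hc', Equiv.symm_apply_apply]

/-- Every bijection between bases has an expansion at each element of its domain. -/
theorem exists_isExpansion [NeZero r] (φ : BasisBij r m t) (ℓ : Fin t) (a : φ.dom) :
    ∃ ψ : BasisBij r m t, IsExpansion φ ψ ∧ ψ.dom = expand φ.dom ℓ a := by
  classical
  let f : BHTWord r m t → BHTWord r m t := fun c =>
    if h : c ∈ φ.dom then φ.map ⟨c, h⟩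
    else if h : ∃ s, child (a : BHTWord r m t) ℓ s = c then child (φ.map a) ℓ h.choose else c
  have f1 : ∀ c : φ.dom, f c = φ.map c := fun c => by simp [f]
  have f2 : ∀ s, f (child a ℓ s) = child (φ.map a) ℓ s := by
    intro s
    have hn := φ.dom_basis.child_notMem a.2 ℓ s
    have hex : ∃ s', child (a : BHTWord r m t) ℓ s' = child a ℓ s := ⟨s, rfl⟩
    have := child_injective _ _ hex.choose_spec
    simp only [f, hn, hex, dif_pos, dif_neg, not_false_eq_true, this]
  have hbij : Set.BijOn f (expand φ.dom ℓ a) (expand φ.cod ℓ (φ.map a)) := by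
    refine ⟨?_, ?_, ?_⟩
    · intro c hc
      rcases mem_expand.1 hc with ⟨hca, hcA⟩ | ⟨s, rfl⟩
      · refine mem_expand.2 (Or.inl ?_)
        rw [f1 ⟨c, hcA⟩]
        exact ⟨fun h => hca (congrArg Subtype.val (φ.map.injective (Subtype.ext h))), (φ.map _).2⟩
      · exact mem_expand.2 (Or.inr ⟨s, (f2 s).symm⟩)
    · intro c hc d hd h
      rcases mem_expand.1 hc with ⟨hca, hcA⟩ | ⟨s, rfl⟩ <;>
        rcases mem_expand.1 hd with ⟨hda, hdA⟩ | ⟨s', rfl⟩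
      · rw [f1 ⟨c, hcA⟩, f1 ⟨d, hdA⟩] at h
        exact congrArg Subtype.val (φ.map.injective (Subtype.ext h))
      · rw [f1 ⟨c, hcA⟩, f2] at h
        exact absurd (h ▸ (φ.map ⟨c, hcA⟩).2) (φ.cod_basis.child_notMem (φ.map a).2 ℓ s')
      · rw [f1 ⟨d, hdA⟩, f2] at h
        exact absurd (h.symm ▸ (φ.map ⟨d, hdA⟩).2) (φ.cod_basis.child_notMem (φ.map a).2 ℓ s)
      · rw [f2, f2] at h
        rw [child_injective _ _ h]
    · intro b hb
      rcases mem_expand.1 hb with ⟨hba, hbB⟩ | ⟨s, rfl⟩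
      · refine ⟨φ.map.symm ⟨b, hbB⟩, mem_expand.2 (Or.inl ⟨?_, (φ.map.symm _).2⟩), ?_⟩
        · intro h
          apply hba
          have := congrArg φ.map (Subtype.ext h)
          rw [Equiv.apply_symm_apply] at this
          exact congrArg Subtype.val this
        · rw [f1, Equiv.apply_symm_apply]
      · exact ⟨child a ℓ s, mem_expand.2 (Or.inr ⟨s, rfl⟩), f2 s⟩
  refine ⟨⟨expand φ.dom ℓ a, expand φ.cod ℓ (φ.map a), φ.dom_basis.expand ℓ a.2,
    φ.cod_basis.expand ℓ (φ.map a).2, Set.BijOn.equiv f hbij⟩, ⟨ℓ, a, rfl, rfl, ?_, ?_⟩, rfl⟩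
  · intro c c' _ h
    change f c' = _
    rw [h, f1]
  · intro s c' h
    change f c' = _
    rw [h, f2]

/-- Expansion towards multi-homogeneous bases terminates: the total weight, in which a word `a`
counts `(r+1)^(∑ ℓ, (n - length of a_ℓ))`, drops. -/
def weight (n : ℕ) (A : Finset (BHTWord r m t)) : ℕ :=
  ∑ a ∈ A, (r + 1) ^ (∑ ℓ, (n - (a.2 ℓ).length))

theorem weight_expand {n : ℕ} {A : Finset (BHTWord r m t)} {a : BHTWord r m t} (ha : a ∈ A)
    {ℓ : Fin t} (h : (a.2 ℓ).length < n) : weight n (expand A ℓ a) < weight n A := by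
  have h1 : ∀ s, (∑ k, (n - ((child a ℓ s).2 k).length)) + 1 = ∑ k, (n - (a.2 k).length) := by
    intro s
    rw [← Finset.add_sum_erase _ _ (Finset.mem_univ ℓ),
      ← Finset.add_sum_erase _ (fun k => n - (a.2 k).length) (Finset.mem_univ ℓ)]
    have : ∑ k ∈ Finset.univ.erase ℓ, (n - ((child a ℓ s).2 k).length) =
        ∑ k ∈ Finset.univ.erase ℓ, (n - (a.2 k).length) := by
      refine Finset.sum_congr rfl fun k hk => ?_
      simp [child, Finset.ne_of_mem_erase hk]
    rw [this]
    simp only [child, Function.update_self, List.length_append, List.length_singleton]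
    omega
  calc weight n (expand A ℓ a)
      ≤ weight n (A.erase a) + weight n (Finset.univ.image (child a ℓ)) := by
        unfold weight expand
        rw [← Finset.sum_union_inter]
        exact Nat.le_add_right _ _
    _ < weight n (A.erase a) + (r + 1) ^ (∑ k, (n - (a.2 k).length)) := by
        refine Nat.add_lt_add_left ?_ _
        unfold weight
        rw [Finset.sum_image fun s _ s' _ h => child_injective a ℓ h]
        obtain ⟨N, hN⟩ : ∃ N, ∑ k, (n - (a.2 k).length) = N + 1 := by
          refine Nat.exists_eq_succ_of_ne_zero (Nat.pos_iff_ne_zero.1 ?_)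
          refine lt_of_lt_of_le ?_ (Finset.single_le_sum (fun _ _ => Nat.zero_le _)
            (Finset.mem_univ ℓ))
          omega
        have h2 : ∀ s, ∑ k, (n - ((child a ℓ s).2 k).length) = N := fun s => by
          have := h1 s; omega
        simp only [h2, hN, Finset.sum_const, Finset.card_univ, Fintype.card_fin, smul_eq_mul]
        rw [pow_succ, mul_comm]
        exact Nat.mul_lt_mul_of_pos_left (Nat.lt_succ_self r) (by positivity)
    _ = weight n A := Finset.sum_erase_add _ _ ha

/-- If all lengths in the domain of `φ` are at most `n`, then `φ` is equivalent to a bijection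
whose domain is multi-homogeneous with all lengths equal to `n`. -/
theorem exists_level_of_le [NeZero r] {n : ℕ} (φ : BasisBij r m t)
    (h : ∀ a ∈ φ.dom, ∀ ℓ, (a.2 ℓ).length ≤ n) :
    ∃ ψ : BasisBij r m t, setoid r m t φ ψ ∧ ∀ a ∈ ψ.dom, a ∈ level r m t n := by
  induction hw : weight n φ.dom using Nat.strong_induction_on generalizing φ with
  | _ w ih =>
    by_cases hl : ∀ a ∈ φ.dom, a ∈ level r m t n
    · exact ⟨φ, (setoid r m t).refl φ, hl⟩
    · obtain ⟨a, ha, ℓ, hℓ⟩ : ∃ a ∈ φ.dom, ∃ ℓ, (a.2 ℓ).length < n := by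
        by_contra! hc
        exact hl fun a ha ℓ => le_antisymm (h a ha ℓ) (hc a ha ℓ)
      obtain ⟨ψ, hψ, hd⟩ := exists_isExpansion φ ℓ ⟨a, ha⟩
      have hle : ∀ c ∈ ψ.dom, ∀ k, (c.2 k).length ≤ n := by
        intro c hc k
        rw [hd] at hc
        rcases mem_expand.1 hc with ⟨-, hcA⟩ | ⟨s, rfl⟩
        · exact h c hcA k
        · by_cases hk : k = ℓ
          · subst hk
            simpa [child] using hℓ
          · simpa [child, hk] using h a ha k
      have hlt : weight n ψ.dom < w := by
        rw [hd, ← hw]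
        exact weight_expand ha hℓ
      obtain ⟨χ, hχ, hχl⟩ := ih _ hlt ψ hle rfl
      exact ⟨χ, (setoid r m t).trans (Relation.EqvGen.rel _ _ hψ) hχ, hχl⟩

theorem exists_level [NeZero r] (φ : BasisBij r m t) :
    ∃ n₀, ∀ n, n₀ ≤ n →
      ∃ ψ : BasisBij r m t, setoid r m t φ ψ ∧ ∀ a ∈ ψ.dom, a ∈ level r m t n := by
  refine ⟨φ.dom.sup fun a => Finset.univ.sup fun ℓ => (a.2 ℓ).length, fun n hn => ?_⟩
  refine exists_level_of_le φ fun a ha ℓ => le_trans ?_ hn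
  exact le_trans (Finset.le_sup (f := fun ℓ => (a.2 ℓ).length) (Finset.mem_univ ℓ))
    (Finset.le_sup (f := fun a : BHTWord r m t => Finset.univ.sup fun ℓ => (a.2 ℓ).length) ha)

theorem setoid_symm {φ ψ : BasisBij r m t} (h : setoid r m t φ ψ) :
    setoid r m t φ.symm ψ.symm := by
  induction h with
  | rel φ ψ h => exact Relation.EqvGen.rel _ _ (isExpansion_symm h)
  | refl φ => exact Relation.EqvGen.refl _
  | symm φ ψ _ ih => exact Relation.EqvGen.symm _ _ ih
  | trans φ ψ χ _ _ ih ih' => exact Relation.EqvGen.trans _ _ _ ih ih'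

/-- The action of a bijection between bases on infinite words, by replacement of prefixes. -/
def act (φ : BasisBij r m t) : Equiv.Perm (Inf r m t) :=
  φ.dom_basis.decomp.symm.trans
    ((φ.map.prodCongr (Equiv.refl (Tail r t))).trans φ.cod_basis.decomp)

theorem act_app (φ : BasisBij r m t) {a : BHTWord r m t} (ha : a ∈ φ.dom) (f : Tail r t) :
    φ.act (app a f) = app (φ.map ⟨a, ha⟩ : BHTWord r m t) f := by
  simp only [act, Equiv.trans_apply, φ.dom_basis.decomp_symm_app ha]
  rfl

theorem act_eq_of_isExpansion {φ ψ : BasisBij r m t} (h : IsExpansion φ ψ) : φ.act = ψ.act := by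
  obtain ⟨ℓ, a, h1, -, h3, h4⟩ := h
  refine Equiv.ext fun ν => ?_
  obtain ⟨⟨⟨c, hc⟩, f⟩, rfl, -⟩ := ψ.dom_basis.existsUnique ν
  dsimp only
  rw [act_app ψ hc]
  have hc' := hc
  rw [h1] at hc'
  rcases mem_expand.1 hc' with ⟨hca, hcA⟩ | ⟨s, rfl⟩
  · rw [act_app φ hcA, h3 ⟨c, hcA⟩ ⟨c, hc⟩ (fun h => hca (congrArg Subtype.val h)) rfl]
  · rw [app_child, act_app φ a.2, h4 s ⟨_, hc⟩ rfl, app_child]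

theorem act_eq_of_setoid {φ ψ : BasisBij r m t} (h : setoid r m t φ ψ) : φ.act = ψ.act := by
  induction h with
  | rel φ ψ h => exact act_eq_of_isExpansion h
  | refl φ => rfl
  | symm φ ψ _ ih => exact ih.symm
  | trans φ ψ χ _ _ ih ih' => exact ih.trans ih'

theorem act_trans (φ ψ : BasisBij r m t) (h : φ.cod = ψ.dom) :
    (φ.trans ψ h).act = ψ.act * φ.act := by
  refine Equiv.ext fun ν => ?_
  obtain ⟨⟨⟨c, hc⟩, f⟩, rfl, -⟩ := φ.dom_basis.existsUnique ν
  dsimp only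
  rw [act_app (φ.trans ψ h) hc, Equiv.Perm.mul_apply, act_app φ hc,
    act_app ψ (h ▸ (φ.map ⟨c, hc⟩).2)]
  rfl

theorem act_refl : (refl r m t).act = 1 := by
  refine Equiv.ext fun ν => ?_
  obtain ⟨⟨⟨c, hc⟩, f⟩, rfl, -⟩ := (refl r m t).dom_basis.existsUnique ν
  dsimp only
  rw [act_app (refl r m t) hc]
  rfl

theorem act_symm (φ : BasisBij r m t) : φ.symm.act = φ.act⁻¹ := rfl

/-- If `a β = b β` for all infinite tails `β`, then `a = b`. -/
theorem eq_of_app_eq [r.AtLeastTwo] {a b : BHTWord r m t} (h : ∀ f : Tail r t, app a f = app b f) :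
    a = b := by
  have hr : 2 ≤ r := Nat.AtLeastTwo.prop
  have key : ∀ u v : List (Fin r), (∀ f : Stream' (Fin r), u ++ₛ f = v ++ₛ f) →
      v.length ≤ u.length := by
    intro u v huv
    by_contra! hlt
    have hne : ∃ c : Fin r, v[u.length] ≠ c := by
      by_cases hv : v[u.length] = ⟨0, by omega⟩
      · exact ⟨⟨1, by omega⟩, by rw [hv]; simp⟩
      · exact ⟨_, hv⟩
    obtain ⟨c, hc⟩ := hne
    have h1 := congrArg (fun s => Stream'.get s u.length) (huv (Stream'.const c))
    rw [Stream'.get_append_length, Stream'.get_append_left _ _ _ hlt] at h1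
    exact hc h1.symm
  have h' : ∀ ℓ, ∀ f : Stream' (Fin r), a.2 ℓ ++ₛ f = b.2 ℓ ++ₛ f := fun ℓ f =>
    congrFun (congrArg Prod.snd (h fun _ => f)) ℓ
  refine Prod.ext (congrArg (fun p : Inf r m t => p.1)
    (h fun _ => Stream'.const ⟨0, by omega⟩) :) (funext fun ℓ => ?_)
  exact Stream'.append_left_injective _ _ _ _ (h' ℓ (Stream'.const ⟨0, by omega⟩))
    (le_antisymm (key _ _ fun f => (h' ℓ f).symm) (key _ _ (h' ℓ)))

theorem setoid_of_act_eq [r.AtLeastTwo] {φ ψ : BasisBij r m t} (h : φ.act = ψ.act) :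
    setoid r m t φ ψ := by
  obtain ⟨n₁, h₁⟩ := exists_level φ
  obtain ⟨n₂, h₂⟩ := exists_level ψ
  obtain ⟨φ', hφ, hφl⟩ := h₁ (max n₁ n₂) (le_max_left _ _)
  obtain ⟨ψ', hψ, hψl⟩ := h₂ (max n₁ n₂) (le_max_right _ _)
  have hact : φ'.act = ψ'.act :=
    (act_eq_of_setoid hφ).symm.trans (h.trans (act_eq_of_setoid hψ))
  have : φ' = ψ' := by
    refine ext' ?_ fun a ha ha' => eq_of_app_eq fun f => ?_
    · ext b
      rw [φ'.dom_basis.mem_of_level hφl, ψ'.dom_basis.mem_of_level hψl]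
    · rw [← act_app, hact, ← act_app]
  subst this
  exact (setoid r m t).trans hφ ((setoid r m t).symm hψ)

/-- Any two bijections are equivalent to two which can be composed. -/
theorem exists_composable [NeZero r] (φ ψ : BasisBij r m t) :
    ∃ φ' ψ' : BasisBij r m t, setoid r m t φ φ' ∧ setoid r m t ψ ψ' ∧ φ'.cod = ψ'.dom := by
  obtain ⟨n₁, h₁⟩ := exists_level φ.symm
  obtain ⟨n₂, h₂⟩ := exists_level ψ
  obtain ⟨φ', hφ, hφl⟩ := h₁ (max n₁ n₂) (le_max_left _ _)
  obtain ⟨ψ', hψ, hψl⟩ := h₂ (max n₁ n₂) (le_max_right _ _)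
  refine ⟨φ'.symm, ψ', setoid_symm hφ, hψ, ?_⟩
  ext b
  change b ∈ φ'.dom ↔ _
  rw [φ'.dom_basis.mem_of_level hφl, ψ'.dom_basis.mem_of_level hψl]

end BasisBij

/-- The Brin-Higman-Thompson group `tV_{r,m}`: the bijections between bases, modulo the identification
of each bijection with all of its expansions. -/
def BrinHigmanThompson (r m t : ℕ) : Type := Quotient (BasisBij.setoid r m t)

namespace BrinHigmanThompson

variable {r m t : ℕ}

/-- The class of a bijection between bases. -/
def mk (φ : BasisBij r m t) : BrinHigmanThompson r m t := Quotient.mk (BasisBij.setoid r m t) φ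

/-- Composition of representatives induces a well-defined binary operation. -/
theorem existsUnique_mul [r.AtLeastTwo] (u v : BrinHigmanThompson r m t) :
    ∃! w : BrinHigmanThompson r m t, ∃ (φ ψ : BasisBij r m t) (h : φ.cod = ψ.dom),
      mk φ = u ∧ mk ψ = v ∧ w = mk (φ.trans ψ h) := by
  induction u using Quotient.inductionOn with | _ φ
  induction v using Quotient.inductionOn with | _ ψ
  obtain ⟨φ', ψ', hφ, hψ, h⟩ := BasisBij.exists_composable φ ψ
  refine ⟨mk (φ'.trans ψ' h), ⟨φ', ψ', h, (Quotient.sound hφ).symm, (Quotient.sound hψ).symm, rfl⟩,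
    ?_⟩
  rintro _ ⟨φ'', ψ'', h', hφ', hψ', rfl⟩
  refine Quotient.sound (BasisBij.setoid_of_act_eq ?_)
  rw [BasisBij.act_trans, BasisBij.act_trans,
    ← BasisBij.act_eq_of_setoid hφ, ← BasisBij.act_eq_of_setoid hψ,
    BasisBij.act_eq_of_setoid (Quotient.exact hφ'), BasisBij.act_eq_of_setoid (Quotient.exact hψ')]

/-- The product of `u` and `v` is the class of `φ ψ` (first `φ`, then `ψ`), for any `φ` in `u` and
`ψ` in `v` which can be composed. -/
instance [r.AtLeastTwo] : Mul (BrinHigmanThompson r m t) where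
  mul u v := (existsUnique_mul u v).choose

theorem mk_mul_mk [r.AtLeastTwo] (φ ψ : BasisBij r m t) (h : φ.cod = ψ.dom) :
    mk φ * mk ψ = mk (φ.trans ψ h) :=
  ((existsUnique_mul (mk φ) (mk ψ)).choose_spec.2 _ ⟨φ, ψ, h, rfl, rfl, rfl⟩).symm

/-- The class of the identity. -/
instance : One (BrinHigmanThompson r m t) where
  one := mk (BasisBij.refl r m t)

/-- The class of the inverse bijection. -/
instance : Inv (BrinHigmanThompson r m t) where
  inv := Quotient.map BasisBij.symm fun _ _ h => BasisBij.setoid_symm h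

theorem inv_mk (φ : BasisBij r m t) : (mk φ)⁻¹ = mk φ.symm := rfl

/-- The action on infinite words. -/
def act : BrinHigmanThompson r m t → Equiv.Perm (Inf r m t) :=
  Quotient.lift BasisBij.act fun _ _ h => BasisBij.act_eq_of_setoid h

theorem act_injective [r.AtLeastTwo] :
    Function.Injective (act : BrinHigmanThompson r m t → Equiv.Perm (Inf r m t)) := by
  intro u v h
  induction u using Quotient.inductionOn with | _ φ
  induction v using Quotient.inductionOn with | _ ψ
  exact Quotient.sound (BasisBij.setoid_of_act_eq h)

theorem act_mul [r.AtLeastTwo] (u v : BrinHigmanThompson r m t) : act (u * v) = act v * act u := by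
  obtain ⟨⟨φ, ψ, h, hu, hv, hw⟩, -⟩ := (existsUnique_mul u v).choose_spec
  change act (existsUnique_mul u v).choose = _
  rw [hw, ← hu, ← hv]
  exact BasisBij.act_trans φ ψ h

instance [r.AtLeastTwo] : Group (BrinHigmanThompson r m t) :=
  Group.ofLeftAxioms
    (fun u v w => act_injective (by simp only [act_mul, mul_assoc]))
    (fun u => act_injective (by
      rw [act_mul]
      change act u * (BasisBij.refl r m t).act = act u
      rw [BasisBij.act_refl, mul_one]))
    (fun u => act_injective (by
      rw [act_mul]
      change act u * act u⁻¹ = (BasisBij.refl r m t).act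
      rw [BasisBij.act_refl]
      induction u using Quotient.inductionOn with | _ φ
      exact mul_inv_cancel φ.act))

end BrinHigmanThompson

/-- The Higman-Thompson group `V_{r,m}`, which is `1V_{r,m}`. -/
abbrev HigmanThompson (r m : ℕ) : Type := BrinHigmanThompson r m 1

end BrinHigmanThompson

end

/-!
Fix a ring with elements `y_{ℓ,k}` and a positive cone, such as `L_r^{⊗ t}`. For a word `a`, write
`a` also for its value in the matrix ring, and `E` for the matrix unit in the corner. By induction
along expansions, every basis `A` is orthonormal and complete: `a^* b = δ_{a,b} E` for `a, b ∈ A`,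
and `∑ a a^* = 1` (`star_toMatrix_mul_of_ne`, `sum_toMatrix_mul_star`). Hence the matrix
`∑ a (a^φ)^*` of a bijection `φ : A → B` is the only matrix `u` with `a^* u = (a^φ)^*` for all
`a ∈ A` (`eq_matrixOf`). From this characterization it is unitary, multiplicative in `φ`, and
unchanged by expansions.

For injectivity, two bijections with the same matrix are expanded until both are defined on the
words whose lengths are all equal to some `n`. They then take the same values, because a word is
determined by its value. This last fact comes from the representation of `L_r` on the
integer-valued functions of infinite words, in which `y k` prepends a letter, and from products of
its matrix coefficients for the tensor powers.

For surjectivity, the relations reduce a positive unitary `u` to a finite sum of terms `a b^*`, and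
expansion gives all words `a` occurring in it the same lengths. Then `a^* u` is a sum
`b₁^* + ⋯ + b_k^*`, and `(b₁ + ⋯ + b_k)^* (b₁ + ⋯ + b_k) = E`. A positive state of the ring,
given by a diagonal matrix coefficient, shows `k = 1` (`card_eq_one`), so that `a = u b` for a
single word `b`. For `t > 2` the words `b` so obtained may be orthonormal and complete without being
a basis. Therefore the pairs `(a, b)` are expanded further, until all words `b` have the same
lengths (`exists_level_of_forall_exists`); the words `a` remain a basis `A`. As `u` is unitary and
`A` is complete, the words `b` are then all words of these lengths, and these form a basis too.

Both rings of the theorem are instances of `IsPositiveLeavittFamily`, which collects the properties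
used.
-/

noncomputable section

/-! ### Values of words -/

/-- A factor which commutes with all entries other than the `ℓ`-th can be moved from the `ℓ`-th
entry to the end of the product. -/
theorem List.prod_ofFn_update_mul {S : Type*} [Monoid S] {t : ℕ} (f : Fin t → S) (ℓ : Fin t)
    (z : S) (h : ∀ k, k ≠ ℓ → Commute z (f k)) :
    (List.ofFn (Function.update f ℓ (f ℓ * z))).prod = (List.ofFn f).prod * z := by
  induction t with
  | zero => exact ℓ.elim0
  | succ t ih =>
    rw [List.ofFn_succ, List.ofFn_succ, List.prod_cons, List.prod_cons]
    refine Fin.cases ?_ (fun ℓ' => ?_) ℓ (motive := fun ℓ => (∀ k, k ≠ ℓ → Commute z (f k)) →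
      Function.update f ℓ (f ℓ * z) 0 *
        (List.ofFn fun i : Fin t => Function.update f ℓ (f ℓ * z) i.succ).prod =
      f 0 * (List.ofFn fun i : Fin t => f i.succ).prod * z) h
    · intro h
      have hc : Commute z (List.ofFn fun i : Fin t => f i.succ).prod := by
        refine Commute.list_prod_right _ _ fun w hw => ?_
        obtain ⟨i, rfl⟩ := List.mem_ofFn.1 hw
        exact h _ (Fin.succ_ne_zero i)
      simp only [Function.update_self, Function.update_of_ne (Fin.succ_ne_zero _)]
      rw [mul_assoc, mul_assoc, hc.eq]
    · intro h
      have hu : (fun i : Fin t => Function.update f ℓ'.succ (f ℓ'.succ * z) i.succ) =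
          Function.update (fun i : Fin t => f i.succ) ℓ' (f ℓ'.succ * z) :=
        Function.update_comp_eq_of_injective f (Fin.succ_injective t) ℓ' _
      rw [Function.update_of_ne (Fin.succ_ne_zero _).symm, hu,
        ih (fun i => f i.succ) ℓ' fun k hk => h _ fun e => hk (Fin.succ_injective t e), mul_assoc]

namespace BHTWord

/-- The value of the word `b₁ ⋯ b_t` when the letter `y_{ℓ,k}` has the value `y ℓ k`. -/
def value {R : Type*} [Ring R] {r t : ℕ} (y : Fin t → Fin r → R) (b : Fin t → List (Fin r)) : R :=
  (List.ofFn fun ℓ => ((b ℓ).map (y ℓ)).prod).prod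

theorem value_nil {R : Type*} [Ring R] {r t : ℕ} (y : Fin t → Fin r → R) :
    value y (fun _ => []) = 1 := by
  simp [value]

theorem toMatrix_eq {R : Type*} [Ring R] {r m t : ℕ} [NeZero m] (y : Fin t → Fin r → R)
    (a : BHTWord r m t) : toMatrix y a = Matrix.single a.1 0 (value y a.2) := rfl

theorem toMatrix_mul_single {R : Type*} [Ring R] {r m t : ℕ} [NeZero m] (y : Fin t → Fin r → R)
    (a : BHTWord r m t) : toMatrix y a * Matrix.single 0 0 1 = toMatrix y a := by
  rw [toMatrix_eq, Matrix.single_mul_single_same, mul_one]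

end BHTWord

open Classical in
/-- The properties of the elements `y_{ℓ,k}` of `L_r^{⊗ t}` and of its positive cone `P` on which
the isomorphism rests. The functionals `τ` are the matrix coefficients of the representation of
the ring on the integer-valued functions of tuples of infinite words; they are nonnegative on `P`
and separate the values of the words. -/
structure IsPositiveLeavittFamily {R : Type*} [Ring R] [StarRing R] {r t : ℕ}
    (y : Fin t → Fin r → R) (P : StarSubsemiring R) : Prop where
  star_mul_self : ∀ ℓ i j, star (y ℓ i) * y ℓ j = if i = j then 1 else 0
  sum_mul_star : ∀ ℓ, ∑ i, y ℓ i * star (y ℓ i) = 1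
  commute : ∀ ℓ k, ℓ ≠ k → ∀ i j, Commute (y ℓ i) (y k j)
  mem : ∀ ℓ i, y ℓ i ∈ P
  le_closure : ∀ p ∈ P, p ∈ AddSubmonoid.closure
    {q | ∃ a b, q = BHTWord.value y a * star (BHTWord.value y b)}
  exists_coeff : ∀ f g : BHTWord.Tail r t, ∃ τ : R →+ ℤ, (∀ p ∈ P, 0 ≤ τ p) ∧
    ∀ b, τ (BHTWord.value y b) = if (fun ℓ => b ℓ ++ₛ f ℓ) = g then 1 else 0

namespace IsPositiveLeavittFamily

open BHTWord

variable {R : Type*} [Ring R] [StarRing R] {r m t : ℕ} [NeZero m] {y : Fin t → Fin r → R}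
  {P : StarSubsemiring R}

theorem star_toMatrix (a : BHTWord r m t) :
    star (toMatrix y a) = Matrix.single 0 a.1 (star (value y a.2)) := by
  rw [toMatrix_eq, Matrix.star_eq_conjTranspose, Matrix.conjTranspose_single]

theorem single_mul_star_toMatrix (a : BHTWord r m t) :
    Matrix.single 0 0 1 * star (toMatrix y a) = star (toMatrix y a) := by
  rw [star_toMatrix, Matrix.single_mul_single_same, one_mul]

variable (y) in
/-- The matrix `∑ a, a (a^φ)^*` of a bijection `φ` between bases. -/
def matrixOf (φ : BasisBij r m t) : Matrix (Fin m) (Fin m) R :=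
  ∑ a : φ.dom, toMatrix y (a : BHTWord r m t) * star (toMatrix y (φ.map a : BHTWord r m t))

theorem matrixOf_symm (φ : BasisBij r m t) : matrixOf y φ.symm = star (matrixOf y φ) := by
  simp only [matrixOf, star_sum, star_mul, star_star]
  refine (Fintype.sum_equiv φ.map _ _ fun a => ?_).symm
  change _ = _ * star (toMatrix y (φ.map.symm (φ.map a) : BHTWord r m t))
  rw [Equiv.symm_apply_apply]

variable (h : IsPositiveLeavittFamily y P)
include h

theorem value_child (b : Fin t → List (Fin r)) (ℓ : Fin t) (s : Fin r) :
    value y (Function.update b ℓ (b ℓ ++ [s])) = value y b * y ℓ s := by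
  unfold value
  rw [← List.prod_ofFn_update_mul _ ℓ]
  · congr 2
    funext k
    by_cases hk : k = ℓ
    · subst hk; simp
    · simp [hk]
  · intro k hk
    refine Commute.list_prod_right _ _ fun w hw => ?_
    obtain ⟨i, -, rfl⟩ := List.mem_map.1 hw
    exact h.commute _ _ hk.symm _ _

theorem value_mem (b : Fin t → List (Fin r)) : value y b ∈ P := by
  refine list_prod_mem fun w hw => ?_
  obtain ⟨ℓ, rfl⟩ := List.mem_ofFn.1 hw
  refine list_prod_mem fun w hw => ?_
  obtain ⟨i, -, rfl⟩ := List.mem_map.1 hw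
  exact h.mem ℓ i

theorem toMatrix_child (a : BHTWord r m t) (ℓ : Fin t) (s : Fin r) :
    toMatrix y (child a ℓ s) = toMatrix y a * Matrix.single 0 0 (y ℓ s) := by
  rw [toMatrix_eq, toMatrix_eq, Matrix.single_mul_single_same]
  exact congrArg _ (h.value_child a.2 ℓ s)

theorem star_toMatrix_child (a : BHTWord r m t) (ℓ : Fin t) (s : Fin r) :
    star (toMatrix y (child a ℓ s)) =
      Matrix.single 0 0 (star (y ℓ s)) * star (toMatrix y a) := by
  rw [h.toMatrix_child, star_mul, Matrix.star_eq_conjTranspose (Matrix.single _ _ _),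
    Matrix.conjTranspose_single]

theorem toMatrix_mul_star_mem (a b : BHTWord r m t) (i j : Fin m) :
    (toMatrix y a * star (toMatrix y b)) i j ∈ P := by
  rw [star_toMatrix, toMatrix_eq, Matrix.single_mul_single_same, Matrix.single_apply]
  split_ifs
  · exact mul_mem (h.value_mem _) (star_mem (h.value_mem _))
  · exact zero_mem P

theorem star_toMatrix_mul_mem (a b : BHTWord r m t) (i j : Fin m) :
    (star (toMatrix y a) * toMatrix y b) i j ∈ P := by
  rw [star_toMatrix, toMatrix_eq]
  by_cases hab : a.1 = b.1
  · rw [hab, Matrix.single_mul_single_same, Matrix.single_apply]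
    split_ifs
    · exact mul_mem (star_mem (h.value_mem _)) (h.value_mem _)
    · exact zero_mem P
  · rw [Matrix.single_mul_single_of_ne _ _ _ _ hab]
    exact zero_mem P

/-- Simultaneous expansion of `a` and `b` does not change `a b^*`, since `∑ s, y_s y_s^* = 1`. -/
theorem sum_child_mul_star (a b : BHTWord r m t) (ℓ : Fin t) :
    ∑ s, toMatrix y (child a ℓ s) * star (toMatrix y (child b ℓ s)) =
      toMatrix y a * star (toMatrix y b) := by
  have h1 : ∀ s, toMatrix y (child a ℓ s) * star (toMatrix y (child b ℓ s)) =
      toMatrix y a * Matrix.single 0 0 (y ℓ s * star (y ℓ s)) * star (toMatrix y b) := by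
    intro s
    have h2 : (Matrix.single 0 0 (y ℓ s * star (y ℓ s)) : Matrix (Fin m) (Fin m) R) =
        Matrix.single 0 0 (y ℓ s) * Matrix.single 0 0 (star (y ℓ s)) :=
      (Matrix.single_mul_single_same ..).symm
    rw [h.star_toMatrix_child, h.toMatrix_child, h2]
    simp only [mul_assoc]
  simp only [h1]
  rw [← Finset.sum_mul, ← Finset.mul_sum]
  have h2 : ∑ s, (Matrix.single 0 0 (y ℓ s * star (y ℓ s)) : Matrix (Fin m) (Fin m) R) =
      Matrix.single 0 0 1 := by
    rw [← h.sum_mul_star ℓ]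
    exact (map_sum (Matrix.singleAddMonoidHom (α := R) (0 : Fin m) (0 : Fin m)) _ _).symm
  rw [h2, toMatrix_mul_single]

/-! ### Bases are orthonormal and complete -/

theorem star_toMatrix_mul_self (a : BHTWord r m t) :
    star (toMatrix y a) * toMatrix y a = Matrix.single 0 0 1 := by
  suffices hv : ∀ n (b : Fin t → List (Fin r)), ∑ ℓ, (b ℓ).length = n →
      star (value y b) * value y b = 1 by
    rw [star_toMatrix, toMatrix_eq, Matrix.single_mul_single_same, hv _ _ rfl]
  intro n
  induction n with
  | zero =>
    intro b hb
    have : b = fun _ => [] := funext fun ℓ => List.length_eq_zero_iff.1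
      (Finset.sum_eq_zero_iff.1 hb ℓ (Finset.mem_univ ℓ))
    rw [this, value_nil, star_one, one_mul]
  | succ n ih =>
    intro b hb
    obtain ⟨ℓ, -, hℓ⟩ : ∃ ℓ ∈ Finset.univ, (b ℓ).length ≠ 0 := by
      apply Finset.exists_ne_zero_of_sum_ne_zero
      omega
    have hne : b ℓ ≠ [] := fun e => hℓ (by rw [e]; rfl)
    let c := Function.update b ℓ (b ℓ).dropLast
    have hbc : b = Function.update c ℓ (c ℓ ++ [(b ℓ).getLast hne]) := by
      simp [c, List.dropLast_append_getLast]
    have hc : ∑ k, (c k).length = n := by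
      rw [← Finset.add_sum_erase _ _ (Finset.mem_univ ℓ)] at hb ⊢
      have : ∑ k ∈ Finset.univ.erase ℓ, (c k).length =
          ∑ k ∈ Finset.univ.erase ℓ, (b k).length :=
        Finset.sum_congr rfl fun k hk => by simp [c, Finset.ne_of_mem_erase hk]
      rw [this]
      simp only [c, Function.update_self, List.length_dropLast]
      omega
    rw [hbc, h.value_child, star_mul, mul_assoc, ← mul_assoc (star (value y c)), ih c hc, one_mul,
      h.star_mul_self, if_pos rfl]

theorem star_toMatrix_mul_of_ne {A : Finset (BHTWord r m t)} (hA : IsBasis A)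
    {a b : BHTWord r m t} (ha : a ∈ A) (hb : b ∈ A) (hab : a ≠ b) :
    star (toMatrix y a) * toMatrix y b = 0 := by
  induction hA generalizing a b with
  | root =>
    obtain ⟨i, -, rfl⟩ := Finset.mem_image.1 ha
    obtain ⟨j, -, rfl⟩ := Finset.mem_image.1 hb
    rw [star_toMatrix, toMatrix_eq]
    exact Matrix.single_mul_single_of_ne _ _ _ _ (fun e => hab (congrArg BHTWord.root e)) _
  | expand hA ℓ hc ih =>
    rename_i A c
    rcases mem_expand.1 ha with ⟨hac, haA⟩ | ⟨s, rfl⟩ <;>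
      rcases mem_expand.1 hb with ⟨hbc, hbA⟩ | ⟨s', rfl⟩
    · exact ih haA hbA hab
    · rw [h.toMatrix_child, ← mul_assoc, ih haA hc hac, zero_mul]
    · rw [h.star_toMatrix_child, mul_assoc, ih hc hbA hbc.symm, mul_zero]
    · have hs : s ≠ s' := fun e => hab (by rw [e])
      rw [h.star_toMatrix_child, h.toMatrix_child, mul_assoc,
        ← mul_assoc (star (toMatrix y _)) (toMatrix y _), h.star_toMatrix_mul_self,
        Matrix.single_mul_single_same, Matrix.single_mul_single_same, one_mul, h.star_mul_self,
        if_neg hs, Matrix.single_zero]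

theorem sum_toMatrix_mul_star [NeZero r] {A : Finset (BHTWord r m t)} (hA : IsBasis A) :
    ∑ a ∈ A, toMatrix y a * star (toMatrix y a) = 1 := by
  induction hA with
  | root =>
    rw [Finset.sum_image fun i _ j _ e => congrArg Prod.fst e]
    have : ∀ i : Fin m, toMatrix y (root i : BHTWord r m t) *
        star (toMatrix y (root i : BHTWord r m t)) = Matrix.single i i 1 := by
      intro i
      rw [star_toMatrix, toMatrix_eq, Matrix.single_mul_single_same]
      change Matrix.single i i (value y (fun _ => []) * star (value y fun _ => [])) = _
      rw [value_nil, star_one, one_mul]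
    simp only [this]
    exact Matrix.sum_single_one
  | expand hA ℓ hc ih =>
    rename_i A c
    have hd : Disjoint (A.erase c) (Finset.univ.image (child c ℓ)) := by
      rw [Finset.disjoint_left]
      intro b hb hb'
      obtain ⟨s, -, rfl⟩ := Finset.mem_image.1 hb'
      exact hA.child_notMem hc ℓ s (Finset.mem_of_mem_erase hb)
    rw [BHTWord.expand, Finset.sum_union hd,
      Finset.sum_image fun s _ s' _ e => child_injective c ℓ e, h.sum_child_mul_star,
      Finset.sum_erase_add _ _ hc, ih]

/-- A matrix is determined by its products with the words of a basis. -/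
theorem ext_of_star_mul [NeZero r] {A : Finset (BHTWord r m t)} (hA : IsBasis A)
    {u v : Matrix (Fin m) (Fin m) R}
    (huv : ∀ a ∈ A, star (toMatrix y a) * u = star (toMatrix y a) * v) : u = v := by
  rw [← one_mul u, ← one_mul v, ← h.sum_toMatrix_mul_star hA, Finset.sum_mul, Finset.sum_mul]
  exact Finset.sum_congr rfl fun a ha => by rw [mul_assoc, huv a ha, mul_assoc]

/-! ### Words are determined by their values -/

/-- A diagonal matrix coefficient is a positive functional with value `1` at `1`. In particular, the
ring is nontrivial. -/
theorem exists_state [NeZero r] : ∃ τ : R →+ ℤ, (∀ p ∈ P, 0 ≤ τ p) ∧ τ 1 = 1 := by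
  obtain ⟨τ, hτ, h1⟩ := h.exists_coeff (fun _ => Stream'.const 0) (fun _ => Stream'.const 0)
  refine ⟨τ, hτ, ?_⟩
  rw [← value_nil (y := y), h1]
  exact if_pos rfl

theorem toMatrix_ne_zero [NeZero r] (a : BHTWord r m t) : toMatrix y a ≠ 0 := by
  intro e
  have h0 := h.star_toMatrix_mul_self a
  rw [e, mul_zero] at h0
  obtain ⟨τ, -, h1⟩ := h.exists_state
  have := congrArg (fun M : Matrix (Fin m) (Fin m) R => τ (M 0 0)) h0
  simp [h1] at this

/-- A matrix coefficient of the value of `a` detects whether `a` maps one given tuple of infinite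
words to another, so the value determines the action of `a` on infinite words. -/
theorem toMatrix_injective [r.AtLeastTwo] {a b : BHTWord r m t}
    (e : toMatrix y a = toMatrix y b) : a = b := by
  have hi : a.1 = b.1 := by
    by_contra hne
    refine h.toMatrix_ne_zero a ?_
    have h0 : value y a.2 = 0 := by
      have h1 := congrArg (fun M : Matrix (Fin m) (Fin m) R => M a.1 0) e
      simpa [toMatrix_eq, Matrix.single_apply, Ne.symm hne] using h1
    rw [toMatrix_eq, h0, Matrix.single_zero]
  refine BasisBij.eq_of_app_eq fun f => Prod.ext hi ?_
  obtain ⟨τ, -, hτ⟩ := h.exists_coeff f (app b f).2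
  have h1 : value y a.2 = value y b.2 := by
    have h1 := congrArg (fun M : Matrix (Fin m) (Fin m) R => M a.1 0) e
    simpa [toMatrix_eq, Matrix.single_apply, hi] using h1
  have h2 := hτ a.2
  rw [h1, hτ b.2, if_pos (show (fun ℓ => b.2 ℓ ++ₛ f ℓ) = (app b f).2 from rfl)] at h2
  by_contra hne
  exact one_ne_zero (h2.trans (if_neg hne))

/-! ### The unitary matrix of a bijection between bases -/

theorem star_mul_matrixOf (φ : BasisBij r m t) (a : φ.dom) :
    star (toMatrix y (a : BHTWord r m t)) * matrixOf y φ =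
      star (toMatrix y (φ.map a : BHTWord r m t)) := by
  rw [matrixOf, Finset.mul_sum, Finset.sum_eq_single a]
  · rw [← mul_assoc, h.star_toMatrix_mul_self, single_mul_star_toMatrix]
  · intro b _ hb
    rw [← mul_assoc, h.star_toMatrix_mul_of_ne φ.dom_basis a.2 b.2
      fun e => hb (Subtype.ext e).symm, zero_mul]
  · simp

/-- `matrixOf y φ` is the only matrix `u` with `a^* u = (a^φ)^*` for all `a` in the domain. -/
theorem eq_matrixOf [NeZero r] {φ : BasisBij r m t} {u : Matrix (Fin m) (Fin m) R}
    (hu : ∀ a : φ.dom, star (toMatrix y (a : BHTWord r m t)) * u =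
      star (toMatrix y (φ.map a : BHTWord r m t))) : u = matrixOf y φ :=
  h.ext_of_star_mul φ.dom_basis fun a ha =>
    (hu ⟨a, ha⟩).trans (h.star_mul_matrixOf φ ⟨a, ha⟩).symm

theorem matrixOf_trans [NeZero r] (φ ψ : BasisBij r m t) (e : φ.cod = ψ.dom) :
    matrixOf y (φ.trans ψ e) = matrixOf y φ * matrixOf y ψ := by
  refine (h.eq_matrixOf fun a => ?_).symm
  rw [← mul_assoc, h.star_mul_matrixOf φ a]
  exact h.star_mul_matrixOf ψ ⟨φ.map a, e ▸ (φ.map a).2⟩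

theorem matrixOf_mul_star [NeZero r] (φ : BasisBij r m t) :
    matrixOf y φ * star (matrixOf y φ) = 1 := by
  refine h.ext_of_star_mul φ.dom_basis fun a ha => ?_
  rw [← matrixOf_symm, ← mul_assoc, h.star_mul_matrixOf φ ⟨a, ha⟩, mul_one]
  refine (h.star_mul_matrixOf φ.symm (φ.map ⟨a, ha⟩)).trans ?_
  change star (toMatrix y (φ.map.symm (φ.map ⟨a, ha⟩) : BHTWord r m t)) = _
  rw [Equiv.symm_apply_apply]

theorem star_matrixOf_mul [NeZero r] (φ : BasisBij r m t) :
    star (matrixOf y φ) * matrixOf y φ = 1 := by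
  have := h.matrixOf_mul_star φ.symm
  rwa [matrixOf_symm, star_star] at this

theorem matrixOf_mem (φ : BasisBij r m t) : matrixOf y φ ∈ matrixCone m P := by
  rw [mem_matrixCone]
  intro i j
  rw [matrixOf, Matrix.sum_apply]
  exact sum_mem fun a _ => h.toMatrix_mul_star_mem _ _ i j

theorem matrixOf_eq_of_isExpansion [NeZero r] {φ ψ : BasisBij r m t}
    (e : BasisBij.IsExpansion φ ψ) : matrixOf y φ = matrixOf y ψ := by
  obtain ⟨ℓ, a, h1, -, h3, h4⟩ := e
  refine h.eq_matrixOf fun ⟨c, hc⟩ => ?_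
  have hc' := hc
  rw [h1] at hc'
  rcases mem_expand.1 hc' with ⟨hca, hcA⟩ | ⟨s, rfl⟩
  · rw [h3 ⟨c, hcA⟩ ⟨c, hc⟩ (fun e => hca (congrArg Subtype.val e)) rfl]
    exact h.star_mul_matrixOf φ ⟨c, hcA⟩
  · rw [h4 s ⟨_, hc⟩ rfl, h.star_toMatrix_child, h.star_toMatrix_child, mul_assoc,
      h.star_mul_matrixOf φ a]

theorem matrixOf_eq_of_setoid [NeZero r] {φ ψ : BasisBij r m t}
    (e : BasisBij.setoid r m t φ ψ) : matrixOf y φ = matrixOf y ψ := by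
  induction e with
  | rel φ ψ e => exact h.matrixOf_eq_of_isExpansion e
  | refl φ => rfl
  | symm φ ψ _ ih => exact ih.symm
  | trans φ ψ χ _ _ ih ih' => exact ih.trans ih'

/-- Expanded to a common multi-homogeneous domain, bijections with the same matrix agree, because
words are determined by their values. -/
theorem setoid_of_matrixOf_eq [r.AtLeastTwo] {φ ψ : BasisBij r m t}
    (e : matrixOf y φ = matrixOf y ψ) : BasisBij.setoid r m t φ ψ := by
  obtain ⟨n₁, h₁⟩ := BasisBij.exists_level φ
  obtain ⟨n₂, h₂⟩ := BasisBij.exists_level ψ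
  obtain ⟨φ', hφ, hφl⟩ := h₁ (max n₁ n₂) (le_max_left _ _)
  obtain ⟨ψ', hψ, hψl⟩ := h₂ (max n₁ n₂) (le_max_right _ _)
  have he : matrixOf y φ' = matrixOf y ψ' :=
    (h.matrixOf_eq_of_setoid hφ).symm.trans (e.trans (h.matrixOf_eq_of_setoid hψ))
  have : φ' = ψ' := by
    refine BasisBij.ext' ?_ fun a ha ha' => h.toMatrix_injective (star_injective ?_)
    · ext b
      rw [φ'.dom_basis.mem_of_level hφl, ψ'.dom_basis.mem_of_level hψl]
    · rw [← h.star_mul_matrixOf φ' ⟨a, ha⟩, ← h.star_mul_matrixOf ψ' ⟨a, ha'⟩, he]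
  subst this
  exact (BasisBij.setoid r m t).trans hφ ((BasisBij.setoid r m t).symm hψ)

/-! ### Every positive unitary matrix comes from a bijection between bases -/

/-- Expansion of `a b^*` to `∑ s, (a y_s) (b y_s)^*` turns any `a b^*` into a sum of such products
in which the first factors are multi-homogeneous. -/
theorem toMatrix_mul_star_mem_closure {n : ℕ} (a b : BHTWord r m t)
    (ha : ∀ ℓ, (a.2 ℓ).length ≤ n) :
    toMatrix y a * star (toMatrix y b) ∈ AddSubmonoid.closure
      {M | ∃ a ∈ level r m t n, ∃ b, M = toMatrix y a * star (toMatrix y b)} := by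
  induction hd : ∑ ℓ, (n - (a.2 ℓ).length) generalizing a b with
  | zero =>
    refine AddSubmonoid.subset_closure ⟨a, fun ℓ => le_antisymm (ha ℓ) ?_, b, rfl⟩
    have := Finset.sum_eq_zero_iff.1 hd ℓ (Finset.mem_univ ℓ)
    omega
  | succ d ih =>
    obtain ⟨ℓ, -, hℓ⟩ : ∃ ℓ ∈ Finset.univ, n - (a.2 ℓ).length ≠ 0 := by
      apply Finset.exists_ne_zero_of_sum_ne_zero
      omega
    rw [← h.sum_child_mul_star a b ℓ]
    refine sum_mem fun s _ => ih (child a ℓ s) (child b ℓ s) (fun k => ?_) ?_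
    · by_cases hk : k = ℓ
      · subst hk
        simp only [child, Function.update_self, List.length_append, List.length_singleton]
        omega
      · simpa [child, hk] using ha k
    · rw [← Finset.add_sum_erase _ _ (Finset.mem_univ ℓ)] at hd ⊢
      have : ∑ k ∈ Finset.univ.erase ℓ, (n - ((child a ℓ s).2 k).length) =
          ∑ k ∈ Finset.univ.erase ℓ, (n - (a.2 k).length) :=
        Finset.sum_congr rfl fun k hk => by simp [child, Finset.ne_of_mem_erase hk]
      rw [this]
      simp only [child, Function.update_self, List.length_append, List.length_singleton]
      omega

theorem single_mem_closure {p : R} (hp : p ∈ P) (i j : Fin m) :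
    Matrix.single i j p ∈ AddSubmonoid.closure
      {M | ∃ a b : BHTWord r m t, M = toMatrix y a * star (toMatrix y b)} := by
  replace hp := h.le_closure p hp
  induction hp using AddSubmonoid.closure_induction with
  | mem p hp =>
    obtain ⟨a, b, rfl⟩ := hp
    refine AddSubmonoid.subset_closure ⟨(i, a), (j, b), ?_⟩
    rw [star_toMatrix, toMatrix_eq, Matrix.single_mul_single_same]
  | zero => rw [Matrix.single_zero]; exact zero_mem _
  | add p q _ _ hp hq => rw [Matrix.single_add]; exact add_mem hp hq

theorem exists_mem_closure_level {u : Matrix (Fin m) (Fin m) R} (hu : u ∈ matrixCone m P) :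
    ∃ n, u ∈ AddSubmonoid.closure
      {M | ∃ a ∈ level r m t n, ∃ b, M = toMatrix y a * star (toMatrix y b)} := by
  have h1 : u ∈ AddSubmonoid.closure
      {M | ∃ a b : BHTWord r m t, M = toMatrix y a * star (toMatrix y b)} := by
    rw [Matrix.matrix_eq_sum_single u]
    exact sum_mem fun i _ => sum_mem fun j _ => h.single_mem_closure (mem_matrixCone.1 hu i j) i j
  clear hu
  suffices ∃ n₀, ∀ n, n₀ ≤ n → u ∈ AddSubmonoid.closure
      {M | ∃ a ∈ level r m t n, ∃ b, M = toMatrix y a * star (toMatrix y b)} from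
    this.imp fun n hn => hn n le_rfl
  induction h1 using AddSubmonoid.closure_induction with
  | mem u hu =>
    obtain ⟨a, b, rfl⟩ := hu
    refine ⟨Finset.univ.sup fun ℓ => (a.2 ℓ).length, fun n hn =>
      h.toMatrix_mul_star_mem_closure a b fun ℓ => le_trans ?_ hn⟩
    exact Finset.le_sup (f := fun ℓ => (a.2 ℓ).length) (Finset.mem_univ ℓ)
  | zero => exact ⟨0, fun n _ => zero_mem _⟩
  | add u v _ _ hu hv =>
    obtain ⟨n₁, h₁⟩ := hu
    obtain ⟨n₂, h₂⟩ := hv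
    exact ⟨max n₁ n₂, fun n hn => add_mem (h₁ n (le_trans (le_max_left _ _) hn))
      (h₂ n (le_trans (le_max_right _ _) hn))⟩

omit h [NeZero m] in
/-- For each `n`, the words with all lengths equal to `n` form a basis. -/
theorem exists_basis_level [NeZero r] (n : ℕ) :
    ∃ A : Finset (BHTWord r m t), IsBasis A ∧ ∀ a, a ∈ A ↔ a ∈ level r m t n := by
  obtain ⟨φ, -, hφ⟩ := BasisBij.exists_level_of_le (BasisBij.refl r m t) (n := n) fun a ha ℓ => by
    obtain ⟨i, -, rfl⟩ := Finset.mem_image.1 ha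
    exact Nat.zero_le n
  exact ⟨φ.dom, φ.dom_basis, φ.dom_basis.mem_of_level hφ⟩

/-- Multiplication by `a^*` picks out the terms `a b^*` with this `a`, by orthogonality of the words
of the same lengths. -/
theorem exists_multiset_of_mem_closure [NeZero r] {n : ℕ} {u : Matrix (Fin m) (Fin m) R}
    (hu : u ∈ AddSubmonoid.closure
      {M | ∃ a ∈ level r m t n, ∃ b, M = toMatrix y a * star (toMatrix y b)})
    {a : BHTWord r m t} (ha : a ∈ level r m t n) :
    ∃ s : Multiset (BHTWord r m t),
      star (toMatrix y a) * u = star (s.map (toMatrix y)).sum := by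
  obtain ⟨A, hA, hAl⟩ := exists_basis_level (r := r) (m := m) (t := t) n
  induction hu using AddSubmonoid.closure_induction with
  | mem u hu =>
    obtain ⟨c, hc, b, rfl⟩ := hu
    by_cases hac : a = c
    · subst hac
      refine ⟨{b}, ?_⟩
      rw [← mul_assoc, h.star_toMatrix_mul_self, single_mul_star_toMatrix, Multiset.map_singleton,
        Multiset.sum_singleton]
    · refine ⟨0, ?_⟩
      rw [← mul_assoc, h.star_toMatrix_mul_of_ne hA ((hAl a).2 ha) ((hAl c).2 hc) hac]
      simp
  | zero => exact ⟨0, by simp⟩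
  | add u v _ _ hu hv =>
    obtain ⟨s, hs⟩ := hu
    obtain ⟨s', hs'⟩ := hv
    exact ⟨s + s', by rw [mul_add, hs, hs', Multiset.map_add, Multiset.sum_add, star_add]⟩

/-- In `(b₁ + ⋯ + b_k)^* (b₁ + ⋯ + b_k)`, the `k` diagonal terms are idempotents of value `1` under
a state, and all others are positive. Hence a sum of words can be isometric only if it has a single
term. -/
theorem card_eq_one [NeZero r] {s : Multiset (BHTWord r m t)}
    (hs : star (s.map (toMatrix y)).sum * (s.map (toMatrix y)).sum = Matrix.single 0 0 1) :
    s.card = 1 := by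
  obtain ⟨τ, hτ, h1⟩ := h.exists_state
  have hpos : ∀ s s' : Multiset (BHTWord r m t), ∀ i j,
      (star (s.map (toMatrix y)).sum * (s'.map (toMatrix y)).sum) i j ∈ P := by
    intro s s' i j
    induction s using Multiset.induction_on with
    | empty => simp
    | cons a s ih =>
      rw [Multiset.map_cons, Multiset.sum_cons, star_add, add_mul, Matrix.add_apply]
      refine add_mem ?_ ih
      clear ih
      induction s' using Multiset.induction_on with
      | empty => simp
      | cons b s' ih =>
        rw [Multiset.map_cons, Multiset.sum_cons, mul_add, Matrix.add_apply]
        exact add_mem (h.star_toMatrix_mul_mem a b i j) ih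
  have key : ∀ s : Multiset (BHTWord r m t), (s.card : ℤ) ≤
      τ ((star (s.map (toMatrix y)).sum * (s.map (toMatrix y)).sum) 0 0) := by
    intro s
    induction s using Multiset.induction_on with
    | empty => simp
    | cons b s ih =>
      have h2 := hτ _ (hpos {b} s 0 0)
      have h3 := hτ _ (hpos s {b} 0 0)
      rw [Multiset.map_singleton, Multiset.sum_singleton] at h2 h3
      rw [Multiset.map_cons, Multiset.sum_cons, star_add, add_mul, mul_add, mul_add,
        h.star_toMatrix_mul_self, Matrix.add_apply, Matrix.add_apply, Matrix.add_apply,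
        Matrix.single_apply_same, map_add, map_add, map_add, h1, Multiset.card_cons]
      push_cast
      linarith
  have h2 := key s
  rw [hs, Matrix.single_apply_same, h1] at h2
  have h3 : s ≠ 0 := by
    rintro rfl
    have h4 := congrArg (fun M : Matrix (Fin m) (Fin m) R => τ (M 0 0)) hs
    simp [h1] at h4
  have h4 := Multiset.card_pos.2 h3
  omega

/-- Expansions of a one-to-one correspondence `a = u b` between words, until the words `b` are
multi-homogeneous. The words `a` always form a basis. -/
theorem exists_level_of_forall_exists [r.AtLeastTwo] {u : Matrix (Fin m) (Fin m) R}
    (huu : star u * u = 1) {N : ℕ}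
    {A B : Finset (BHTWord r m t)} (hA : IsBasis A)
    (hAB : ∀ a ∈ A, ∃ b ∈ B, toMatrix y a = u * toMatrix y b)
    (hBA : ∀ b ∈ B, ∃ a ∈ A, toMatrix y a = u * toMatrix y b)
    (hN : ∀ b ∈ B, ∀ ℓ, (b.2 ℓ).length ≤ N) :
    ∃ A' B' : Finset (BHTWord r m t), IsBasis A' ∧
      (∀ a ∈ A', ∃ b ∈ B', toMatrix y a = u * toMatrix y b) ∧
      (∀ b ∈ B', ∃ a ∈ A', toMatrix y a = u * toMatrix y b) ∧ ∀ b ∈ B', b ∈ level r m t N := by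
  induction hw : BasisBij.weight N B using Nat.strong_induction_on generalizing A B with
  | _ w ih =>
    by_cases hl : ∀ b ∈ B, b ∈ level r m t N
    · exact ⟨A, B, hA, hAB, hBA, hl⟩
    obtain ⟨b, hb, ℓ, hℓ⟩ : ∃ b ∈ B, ∃ ℓ, (b.2 ℓ).length < N := by
      by_contra! hc
      exact hl fun b hb ℓ => le_antisymm (hN b hb ℓ) (hc b hb ℓ)
    obtain ⟨a, ha, hab⟩ := hBA b hb
    have hchild : ∀ s, toMatrix y (child a ℓ s) = u * toMatrix y (child b ℓ s) := fun s => by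
      rw [h.toMatrix_child, h.toMatrix_child, hab, mul_assoc]
    have hinj : ∀ c c' : BHTWord r m t, u * toMatrix y c = u * toMatrix y c' → c = c' :=
      fun c c' e => h.toMatrix_injective (by
        rw [← one_mul (toMatrix y c), ← huu, mul_assoc, e, ← mul_assoc, huu, one_mul])
    refine ih _ (hw ▸ BasisBij.weight_expand hb hℓ) (hA.expand ℓ ha) ?_ ?_ ?_ rfl
    · intro c hc
      rcases mem_expand.1 hc with ⟨hca, hcA⟩ | ⟨s, rfl⟩
      · obtain ⟨d, hd, hcd⟩ := hAB c hcA
        refine ⟨d, mem_expand.2 (Or.inl ⟨?_, hd⟩), hcd⟩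
        rintro rfl
        exact hca (h.toMatrix_injective (hcd.trans hab.symm))
      · exact ⟨_, mem_expand.2 (Or.inr ⟨s, rfl⟩), hchild s⟩
    · intro d hd
      rcases mem_expand.1 hd with ⟨hdb, hdB⟩ | ⟨s, rfl⟩
      · obtain ⟨c, hc, hcd⟩ := hBA d hdB
        refine ⟨c, mem_expand.2 (Or.inl ⟨?_, hc⟩), hcd⟩
        rintro rfl
        exact hdb (hinj _ _ (hcd.symm.trans hab))
      · exact ⟨_, mem_expand.2 (Or.inr ⟨s, rfl⟩), hchild s⟩
    · intro c hc k
      rcases mem_expand.1 hc with ⟨-, hcB⟩ | ⟨s, rfl⟩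
      · exact hN c hcB k
      · by_cases hk : k = ℓ
        · subst hk
          simpa [child] using hℓ
        · simpa [child, hk] using hN b hb k

/-- A unitary matrix which maps a basis `B` onto a basis `A` is the matrix of a bijection. -/
theorem exists_matrixOf_eq_of_forall_exists [r.AtLeastTwo] {u : Matrix (Fin m) (Fin m) R}
    (huu : star u * u = 1) {A B : Finset (BHTWord r m t)} (hA : IsBasis A) (hB : IsBasis B)
    (hAB : ∀ a ∈ A, ∃ b ∈ B, toMatrix y a = u * toMatrix y b)
    (hBA : ∀ b ∈ B, ∃ a ∈ A, toMatrix y a = u * toMatrix y b) :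
    ∃ φ : BasisBij r m t, matrixOf y φ = u := by
  have hadj : ∀ a b : BHTWord r m t, toMatrix y a = u * toMatrix y b →
      star (toMatrix y a) * u = star (toMatrix y b) := fun a b e => by
    rw [e, star_mul, mul_assoc, huu, mul_one]
  choose! g hgB hg using hAB
  have hG : Set.BijOn g A B := by
    refine ⟨hgB, fun a ha a' ha' e => ?_, fun b hb => ?_⟩
    · exact h.toMatrix_injective (by rw [hg a ha, e, ← hg a' ha'])
    · obtain ⟨a, ha, hab⟩ := hBA b hb
      refine ⟨a, ha, h.toMatrix_injective (y := y) (star_injective ?_)⟩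
      rw [← hadj a (g a) (hg a ha), ← hadj a b hab]
  let φ : BasisBij r m t := ⟨A, B, hA, hB, hG.equiv g⟩
  refine ⟨φ, (h.eq_matrixOf fun a => ?_).symm⟩
  exact hadj a (g a) (hg a a.2)

theorem exists_matrixOf_eq [r.AtLeastTwo] {u : Matrix (Fin m) (Fin m) R}
    (hu : u ∈ matrixCone m P) (huu : star u * u = 1) (huu' : u * star u = 1) :
    ∃ φ : BasisBij r m t, matrixOf y φ = u := by
  obtain ⟨n, hn⟩ := h.exists_mem_closure_level hu
  obtain ⟨A₀, hA₀, hAl⟩ := exists_basis_level (r := r) (m := m) (t := t) n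
  have h₀ : ∀ a ∈ A₀, ∃ b : BHTWord r m t, toMatrix y a = u * toMatrix y b := by
    intro a ha
    obtain ⟨s, hs⟩ := h.exists_multiset_of_mem_closure hn ((hAl a).1 ha)
    have hs' : (s.map (toMatrix y)).sum = star u * toMatrix y a := by
      rw [← star_star (s.map (toMatrix y)).sum, ← hs, star_mul, star_star]
    obtain ⟨b, rfl⟩ := Multiset.card_eq_one.1 (h.card_eq_one (s := s) (by
      rw [hs', star_mul, star_star, mul_assoc, ← mul_assoc u, huu', one_mul,
        h.star_toMatrix_mul_self]))
    rw [Multiset.map_singleton, Multiset.sum_singleton] at hs'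
    exact ⟨b, by rw [hs', ← mul_assoc, huu', one_mul]⟩
  choose! f hf using h₀
  obtain ⟨N, hN⟩ : ∃ N, ∀ b ∈ A₀.image f, ∀ ℓ, (b.2 ℓ).length ≤ N :=
    ⟨(A₀.image f).sup fun b => Finset.univ.sup fun ℓ => (b.2 ℓ).length, fun b hb ℓ => le_trans
      (Finset.le_sup (f := fun ℓ => (b.2 ℓ).length) (Finset.mem_univ ℓ))
      (Finset.le_sup (f := fun b : BHTWord r m t => Finset.univ.sup fun ℓ => (b.2 ℓ).length) hb)⟩
  obtain ⟨A, B, hA, hAB, hBA, hB⟩ := h.exists_level_of_forall_exists huu hA₀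
    (fun a ha => ⟨f a, Finset.mem_image_of_mem f ha, hf a ha⟩)
    (fun b hb => by
      obtain ⟨a, ha, rfl⟩ := Finset.mem_image.1 hb
      exact ⟨a, ha, hf a ha⟩) hN
  obtain ⟨C, hC, hCl⟩ := exists_basis_level (r := r) (m := m) (t := t) N
  -- A multi-homogeneous word `c` outside `B` would satisfy `a^* u c = 0` for all `a` in `A`.
  have hBC : B = C := by
    refine Finset.Subset.antisymm (fun b hb => (hCl b).2 (hB b hb)) fun c hc => ?_
    by_contra hcB
    refine h.toMatrix_ne_zero c ?_
    have h0 : u * toMatrix y c = 0 := by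
      refine h.ext_of_star_mul hA fun a ha => ?_
      obtain ⟨b, hb, hab⟩ := hAB a ha
      rw [hab, star_mul, mul_assoc, ← mul_assoc (star u), huu, one_mul, mul_zero]
      exact h.star_toMatrix_mul_of_ne hC ((hCl b).2 (hB b hb)) hc fun e => hcB (e ▸ hb)
    rw [← one_mul (toMatrix y c), ← huu, mul_assoc, h0, mul_zero]
  subst hBC
  exact h.exists_matrixOf_eq_of_forall_exists huu hA hC hAB hBA

/-- The isomorphism, for any ring with a family of elements with the properties of the `y_{ℓ,k}`. -/
theorem exists_mulEquiv [r.AtLeastTwo] :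
    ∃ α : BrinHigmanThompson r m t ≃* PU m P, ∀ φ : BasisBij r m t,
      ((α (BrinHigmanThompson.mk φ) : unitary (Matrix (Fin m) (Fin m) R)) :
        Matrix (Fin m) (Fin m) R) =
      ∑ a : φ.dom, toMatrix y (a : BHTWord r m t) *
        star (toMatrix y (φ.map a : BHTWord r m t)) := by
  let F : BasisBij r m t → PU m P := fun φ =>
    ⟨⟨matrixOf y φ, Unitary.mem_iff.2 ⟨h.star_matrixOf_mul φ, h.matrixOf_mul_star φ⟩⟩,
      h.matrixOf_mem φ⟩
  have hF : ∀ {φ ψ : BasisBij r m t}, F φ = F ψ ↔ matrixOf y φ = matrixOf y ψ := fun {φ ψ} =>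
    ⟨fun e => congrArg (fun v : PU m P =>
      ((v : unitary (Matrix (Fin m) (Fin m) R)) : Matrix (Fin m) (Fin m) R)) e,
      fun e => Subtype.ext (Subtype.ext e)⟩
  let G : BrinHigmanThompson r m t → PU m P :=
    Quotient.lift F fun _ _ e => hF.2 (h.matrixOf_eq_of_setoid e)
  have hG : Function.Bijective G := by
    constructor
    · intro v w e
      induction v using Quotient.inductionOn with | _ φ
      induction w using Quotient.inductionOn with | _ ψ
      exact Quotient.sound (h.setoid_of_matrixOf_eq (hF.1 e))
    · rintro ⟨⟨u, hu⟩, hP⟩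
      obtain ⟨φ, hφ⟩ := h.exists_matrixOf_eq hP (Unitary.mem_iff.1 hu).1 (Unitary.mem_iff.1 hu).2
      exact ⟨BrinHigmanThompson.mk φ, Subtype.ext (Subtype.ext hφ)⟩
  refine ⟨MulEquiv.mk' (Equiv.ofBijective G hG) fun v w => ?_, fun φ => rfl⟩
  obtain ⟨⟨φ, ψ, e, rfl, rfl, -⟩, -⟩ := (BrinHigmanThompson.existsUnique_mul v w).choose_spec
  rw [BrinHigmanThompson.mk_mul_mk φ ψ e]
  exact Subtype.ext (Subtype.ext (h.matrixOf_trans φ ψ e))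

end IsPositiveLeavittFamily

/-! ### The representation of the Leavitt ring on functions of infinite words -/

namespace Leavitt

variable {r : ℕ}

/-- The action of `x i` on functions of infinite words: `v` goes to `g ↦ v (i g)`. -/
def xAction (i : Fin r) : Module.End ℤ (Stream' (Fin r) → ℤ) where
  toFun v g := v (Stream'.cons i g)
  map_add' _ _ := rfl
  map_smul' _ _ := rfl

/-- The action of `y i` on functions of infinite words: `y i` moves the value of a function at `g`
to the word `i g`. -/
def yAction (i : Fin r) : Module.End ℤ (Stream' (Fin r) → ℤ) where
  toFun v g := if g.head = i then v g.tail else 0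
  map_add' v w := by
    funext g
    by_cases h : g.head = i <;> simp [h]
  map_smul' n v := by
    funext g
    by_cases h : g.head = i <;> simp [h]

/-- The representation of `L_r` on the integer-valued functions of infinite words. -/
def rep (r : ℕ) : Leavitt r →+* Module.End ℤ (Stream' (Fin r) → ℤ) :=
  RingQuot.lift ⟨((FreeAlgebra.lift ℤ (Sum.elim xAction yAction) :
      FreeAlgebra ℤ (Fin r ⊕ Fin r) →ₐ[ℤ] Module.End ℤ (Stream' (Fin r) → ℤ)) :
      FreeAlgebra ℤ (Fin r ⊕ Fin r) →+* Module.End ℤ (Stream' (Fin r) → ℤ)), by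
    intro a b h
    cases h with
    | xy i j =>
      simp only [RingHom.coe_coe, map_mul, FreeAlgebra.lift_ι_apply, Sum.elim_inl, Sum.elim_inr]
      refine LinearMap.ext fun v => funext fun g => ?_
      by_cases hij : i = j
      · subst hij
        simp [xAction, yAction]
      · simp [xAction, yAction, hij]
    | yx =>
      simp only [RingHom.coe_coe, map_sum, map_mul, FreeAlgebra.lift_ι_apply, Sum.elim_inl,
        Sum.elim_inr, map_one]
      refine LinearMap.ext fun v => funext fun g => ?_
      simp [xAction, yAction, LinearMap.sum_apply, Finset.sum_apply, Stream'.eta]⟩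

theorem rep_x (i : Fin r) : rep r (x i) = xAction i := by
  simp only [rep, x, proj]
  erw [RingQuot.lift_mkRingHom_apply]
  simp

theorem rep_y (i : Fin r) : rep r (y i) = yAction i := by
  simp only [rep, y, proj]
  erw [RingQuot.lift_mkRingHom_apply]
  simp

theorem rep_nonneg {p : Leavitt r} (hp : p ∈ cone r) {v : Stream' (Fin r) → ℤ} (hv : 0 ≤ v) :
    0 ≤ rep r p v := by
  replace hp : p ∈ (monomials r).subsemiringClosure := hp
  rw [Submonoid.subsemiringClosure_mem] at hp
  induction hp using AddSubmonoid.closure_induction with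
  | mem p hp =>
    replace hp : p ∈ Submonoid.closure (Set.range x ∪ Set.range y) := hp
    induction hp using Submonoid.closure_induction generalizing v with
    | mem p hp =>
      rcases hp with ⟨i, rfl⟩ | ⟨i, rfl⟩
      · rw [rep_x]
        exact fun g => hv _
      · rw [rep_y]
        intro g
        change 0 ≤ if g.head = i then v g.tail else 0
        split_ifs
        · exact hv _
        · exact le_rfl
    | one => simpa using hv
    | mul p q _ _ hp hq => rw [map_mul]; exact hp (hq hv)
  | zero => simp
  | add p q _ _ hp hq => rw [map_add]; exact add_nonneg hp hq

open Classical in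
theorem rep_list_prod (b : List (Fin r)) (f : Stream' (Fin r)) :
    rep r (b.map y).prod (Pi.single f 1) = Pi.single (b ++ₛ f) 1 := by
  induction b with
  | nil => simp [Stream'.nil_append_stream]
  | cons i b ih =>
    rw [List.map_cons, List.prod_cons, map_mul, rep_y, Module.End.mul_apply, ih,
      Stream'.cons_append_stream]
    funext g
    change (if g.head = i then (Pi.single (b ++ₛ f) 1 : Stream' (Fin r) → ℤ) g.tail else 0) = _
    rw [Pi.single_apply, Pi.single_apply]
    by_cases hg : g = Stream'.cons i (b ++ₛ f)
    · subst hg; simp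
    · rw [if_neg hg]
      split_ifs with h1 h2
      · exact absurd (by rw [← h1, ← h2, Stream'.eta]) hg
      · rfl
      · rfl

open Classical in
/-- The matrix coefficient of the representation at the infinite words `f` and `g`. -/
def coeff (f g : Stream' (Fin r)) : Leavitt r →+ ℤ where
  toFun p := rep r p (Pi.single f 1) g
  map_zero' := by simp
  map_add' p q := by simp

open Classical in
theorem coeff_nonneg (f g : Stream' (Fin r)) {p : Leavitt r} (hp : p ∈ cone r) :
    0 ≤ coeff f g p :=
  rep_nonneg hp (Pi.single_nonneg.2 zero_le_one) g

open Classical in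
theorem coeff_list_prod (f g : Stream' (Fin r)) (b : List (Fin r)) :
    coeff f g (b.map y).prod = if b ++ₛ f = g then 1 else 0 := by
  change rep r (b.map y).prod (Pi.single f 1) g = _
  rw [rep_list_prod, Pi.single_apply]
  simp only [eq_comm]

theorem y_mem_cone (i : Fin r) : y i ∈ cone r := by
  change y i ∈ (monomials r).subsemiringClosure
  rw [Submonoid.subsemiringClosure_mem]
  exact AddSubmonoid.subset_closure (Submonoid.subset_closure (Or.inr ⟨i, rfl⟩))

/-- Every nonzero monomial reduces to a word in the `y i` times a word in the `x i`. -/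
theorem monomials_eq {p : Leavitt r} (hp : p ∈ monomials r) :
    p = 0 ∨ ∃ a b : List (Fin r), p = (a.map y).prod * star (b.map y).prod := by
  replace hp : p ∈ Submonoid.closure (Set.range x ∪ Set.range y) := hp
  induction hp using Submonoid.closure_induction_left with
  | one => exact Or.inr ⟨[], [], by simp⟩
  | mul_left p hp q _ ih =>
    rcases ih with rfl | ⟨a, b, rfl⟩
    · exact Or.inl (mul_zero _)
    rcases hp with ⟨i, rfl⟩ | ⟨i, rfl⟩
    · cases a with
      | nil => exact Or.inr ⟨[], b ++ [i], by simp⟩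
      | cons j a =>
        rw [List.map_cons, List.prod_cons, mul_assoc, ← mul_assoc, x_mul_y]
        split_ifs
        · exact Or.inr ⟨a, b, one_mul _⟩
        · exact Or.inl (zero_mul _)
    · exact Or.inr ⟨i :: a, b, by simp [mul_assoc]⟩

theorem mem_closure_of_mem_cone {p : Leavitt r} (hp : p ∈ cone r) :
    p ∈ AddSubmonoid.closure
      {q | ∃ a b : List (Fin r), q = (a.map y).prod * star (b.map y).prod} := by
  replace hp : p ∈ (monomials r).subsemiringClosure := hp
  rw [Submonoid.subsemiringClosure_mem] at hp
  induction hp using AddSubmonoid.closure_induction with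
  | mem p hp =>
    rcases monomials_eq hp with rfl | hp
    · exact zero_mem _
    · exact AddSubmonoid.subset_closure hp
  | zero => exact zero_mem _
  | add p q _ _ hp hq => exact add_mem hp hq

theorem isPositiveLeavittFamily :
    IsPositiveLeavittFamily (fun _ : Fin 1 => (y : Fin r → Leavitt r)) (cone r) where
  star_mul_self _ i j := by rw [star_y, x_mul_y]
  sum_mul_star _ := by simp only [star_y, sum_y_mul_x]
  commute ℓ k h := absurd (Subsingleton.elim ℓ k) h
  mem _ i := y_mem_cone i
  le_closure p hp := by
    refine AddSubmonoid.closure_mono ?_ (mem_closure_of_mem_cone hp)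
    rintro q ⟨a, b, rfl⟩
    exact ⟨fun _ => a, fun _ => b, by simp [BHTWord.value]⟩
  exists_coeff f g := by
    refine ⟨coeff (f 0) (g 0), fun p hp => coeff_nonneg _ _ hp, fun b => ?_⟩
    have h1 : ((fun ℓ => b ℓ ++ₛ f ℓ) = g) ↔ b 0 ++ₛ f 0 = g 0 :=
      ⟨fun e => congrFun e 0, fun e => funext fun ℓ => by rw [Subsingleton.elim ℓ 0, e]⟩
    have h2 : BHTWord.value (fun _ : Fin 1 => (y : Fin r → Leavitt r)) b = ((b 0).map y).prod := by
      simp [BHTWord.value]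
    rw [h2, coeff_list_prod]
    congr 1
    exact propext h1.symm

end Leavitt

/-! ### Tensor powers -/

/-- A multilinear map expands sums in each argument, hence maps tuples from the additive closures of
`T i` into the additive closure of its values on tuples from `T i`. -/
theorem MultilinearMap.mem_closure_image_pi {S : Type*} [Ring S] {ι : Type*} [Fintype ι]
    {M : ι → Type*} {N : Type*} [∀ i, AddCommMonoid (M i)] [∀ i, Module S (M i)] [AddCommMonoid N]
    [Module S N] (F : MultilinearMap S M N) {T : ∀ i, Set (M i)} {p : ∀ i, M i}
    (hp : ∀ i, p i ∈ AddSubmonoid.closure (T i)) :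
    F p ∈ AddSubmonoid.closure (F '' Set.univ.pi T) := by
  classical
  suffices ∀ s : Finset ι, ∀ p : ∀ i, M i, (∀ i ∈ s, p i ∈ AddSubmonoid.closure (T i)) →
      (∀ i ∉ s, p i ∈ T i) → F p ∈ AddSubmonoid.closure (F '' Set.univ.pi T) from
    this Finset.univ p (fun i _ => hp i) fun i hi => absurd (Finset.mem_univ i) hi
  intro s
  induction s using Finset.induction_on with
  | empty =>
    exact fun p _ h => AddSubmonoid.subset_closure ⟨p, fun i _ => h i (Finset.notMem_empty i), rfl⟩
  | insert i s hi ih =>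
    intro p h1 h2
    suffices ∀ z ∈ AddSubmonoid.closure (T i),
        F (Function.update p i z) ∈ AddSubmonoid.closure (F '' Set.univ.pi T) by
      simpa using this (p i) (h1 i (Finset.mem_insert_self i s))
    intro z hz
    induction hz using AddSubmonoid.closure_induction with
    | mem z hz =>
      refine ih _ (fun k hk => ?_) fun k hk => ?_
      · rw [Function.update_of_ne (by rintro rfl; exact hi hk)]
        exact h1 k (Finset.mem_insert_of_mem hk)
      · by_cases hki : k = i
        · subst hki; simpa using hz
        · rw [Function.update_of_ne hki]
          exact h2 k fun h => (Finset.mem_insert.1 h).elim hki hk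
    | zero => rw [F.map_update_zero]; exact zero_mem _
    | add z w _ _ hz hw => rw [F.map_update_add]; exact add_mem hz hw

namespace LeavittTensor

variable {r t : ℕ}

theorem y_eq_singleAlgHom (ℓ : Fin t) (k : Fin r) :
    (y ℓ k : LeavittTensor r t) =
      PiTensorProduct.singleAlgHom (R := ℤ) (A := fun _ => Leavitt r) ℓ (Leavitt.y k) := rfl

theorem star_y_eq_singleAlgHom (ℓ : Fin t) (k : Fin r) :
    star (y ℓ k : LeavittTensor r t) =
      PiTensorProduct.singleAlgHom (R := ℤ) (A := fun _ => Leavitt r) ℓ (Leavitt.x k) := by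
  rw [y, star_tprod]
  change _ = PiTensorProduct.tprod ℤ (Function.update (1 : Fin t → Leavitt r) ℓ (Leavitt.x k))
  congr 1
  funext j
  by_cases hj : j = ℓ
  · subst hj; simp
  · simp [hj]

theorem value_eq (b : Fin t → List (Fin r)) :
    BHTWord.value y b =
      (PiTensorProduct.tprod ℤ fun ℓ => ((b ℓ).map Leavitt.y).prod : LeavittTensor r t) := by
  have h1 : ∀ ℓ, ((b ℓ).map (y ℓ)).prod = (PiTensorProduct.tprodMonoidHom ℤ
      (Function.update (1 : Fin t → Leavitt r) ℓ ((b ℓ).map Leavitt.y).prod) :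
      LeavittTensor r t) := by
    intro ℓ
    change _ = PiTensorProduct.singleAlgHom (R := ℤ) (A := fun _ => Leavitt r) ℓ _
    rw [map_list_prod, List.map_map]
    rfl
  simp only [BHTWord.value, h1]
  rw [← Function.comp_def (PiTensorProduct.tprodMonoidHom ℤ), ← List.map_ofFn, ← map_list_prod]
  change PiTensorProduct.tprod ℤ _ = _
  congr 1
  funext k
  change Pi.evalMonoidHom (fun _ : Fin t => Leavitt r) k (List.ofFn fun ℓ =>
    Function.update (1 : Fin t → Leavitt r) ℓ ((b ℓ).map Leavitt.y).prod).prod = _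
  rw [map_list_prod, List.map_ofFn]
  have h2 : (⇑(Pi.evalMonoidHom (fun _ : Fin t => Leavitt r) k) ∘ fun ℓ =>
      Function.update (1 : Fin t → Leavitt r) ℓ ((b ℓ).map Leavitt.y).prod) =
      Function.update (fun _ => 1) k (1 * ((b k).map Leavitt.y).prod) := by
    funext ℓ
    by_cases hk : ℓ = k
    · subst hk; simp
    · simp [hk, Ne.symm hk]
  rw [h2, List.prod_ofFn_update_mul (fun _ : Fin t => (1 : Leavitt r)) k _
    fun _ _ => Commute.one_right _]
  simp

/-- The product of the matrix coefficients at `f ℓ` and `g ℓ` of the factors. -/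
def coeff (f g : BHTWord.Tail r t) : LeavittTensor r t →ₗ[ℤ] ℤ :=
  PiTensorProduct.lift ((MultilinearMap.mkPiAlgebra ℤ (Fin t) ℤ).compLinearMap
    fun ℓ => (Leavitt.coeff (f ℓ) (g ℓ)).toIntLinearMap)

theorem coeff_tprod (f g : BHTWord.Tail r t) (p : Fin t → Leavitt r) :
    coeff f g (PiTensorProduct.tprod ℤ p) = ∏ ℓ, Leavitt.coeff (f ℓ) (g ℓ) (p ℓ) := by
  simp [coeff]

theorem mem_closure_of_mem_cone {p : LeavittTensor r t} (hp : p ∈ cone r t) :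
    p ∈ AddSubmonoid.closure (positiveTensors r t : Set (LeavittTensor r t)) := by
  replace hp : p ∈ (positiveTensors r t).subsemiringClosure := hp
  rwa [Submonoid.subsemiringClosure_mem] at hp

theorem isPositiveLeavittFamily :
    IsPositiveLeavittFamily (y : Fin t → Fin r → LeavittTensor r t) (cone r t) where
  star_mul_self ℓ i j := by
    rw [star_y_eq_singleAlgHom, y_eq_singleAlgHom, ← map_mul, Leavitt.x_mul_y]
    split_ifs
    exacts [map_one _, map_zero _]
  sum_mul_star ℓ := by
    simp only [star_y_eq_singleAlgHom]
    simp only [y_eq_singleAlgHom]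
    simp only [← map_mul, ← map_sum, Leavitt.sum_y_mul_x, map_one]
  commute ℓ k hℓk i j := by
    refine Commute.tprod ?_
    refine funext fun n => ?_
    by_cases hn : n = ℓ
    · subst hn; simp [hℓk]
    · simp [hn]
  mem ℓ i := by
    change _ ∈ (positiveTensors r t).subsemiringClosure
    rw [Submonoid.subsemiringClosure_mem]
    refine AddSubmonoid.subset_closure ⟨_, fun k => ?_, rfl⟩
    by_cases hk : k = ℓ
    · subst hk; simpa using Leavitt.y_mem_cone i
    · simp [hk]
  le_closure p hp := by
    replace hp := mem_closure_of_mem_cone hp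
    induction hp using AddSubmonoid.closure_induction with
    | mem p h =>
      obtain ⟨p, hp, rfl⟩ := h
      refine AddSubmonoid.closure_mono ?_ (MultilinearMap.mem_closure_image_pi
        (PiTensorProduct.tprod ℤ) fun ℓ => Leavitt.mem_closure_of_mem_cone (hp ℓ))
      rintro _ ⟨q, hq, rfl⟩
      choose a b hab using fun ℓ => hq ℓ (Set.mem_univ ℓ)
      refine ⟨a, b, ?_⟩
      rw [value_eq, value_eq, star_tprod, PiTensorProduct.tprod_mul_tprod]
      exact congrArg _ (funext hab)
    | zero => exact zero_mem _
    | add p q _ _ hp hq => exact add_mem hp hq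
  exists_coeff f g := by
    refine ⟨(coeff f g).toAddMonoidHom, fun p hp => ?_, fun b => ?_⟩
    · replace hp := mem_closure_of_mem_cone hp
      induction hp using AddSubmonoid.closure_induction with
      | mem p h =>
        obtain ⟨p, hp, rfl⟩ := h
        change 0 ≤ coeff f g (PiTensorProduct.tprod ℤ p)
        rw [coeff_tprod]
        exact Finset.prod_nonneg fun ℓ _ => Leavitt.coeff_nonneg _ _ (hp ℓ)
      | zero => rw [map_zero]
      | add p q _ _ hp hq => rw [map_add]; exact add_nonneg hp hq
    · change coeff f g (BHTWord.value y b) = _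
      rw [value_eq, coeff_tprod]
      simp only [Leavitt.coeff_list_prod, Finset.prod_ite_zero, Finset.prod_const_one]
      congr 1
      simp [funext_iff]

end LeavittTensor

end

theorem theorem5p3 (r m t : ℕ) [r.AtLeastTwo] [NeZero m] [NeZero t] :
    (∃ α : BrinHigmanThompson r m t ≃* PU m (LeavittTensor.cone r t),
      ∀ φ : BasisBij r m t,
        ((α (BrinHigmanThompson.mk φ) : unitary (Matrix (Fin m) (Fin m) (LeavittTensor r t))) :
            Matrix (Fin m) (Fin m) (LeavittTensor r t)) =
          ∑ a : φ.dom, BHTWord.toMatrix LeavittTensor.y (a : BHTWord r m t) *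
            star (BHTWord.toMatrix LeavittTensor.y (φ.map a : BHTWord r m t))) ∧
    (∃ β : HigmanThompson r m ≃* PU m (Leavitt.cone r),
      ∀ φ : BasisBij r m 1,
        ((β (BrinHigmanThompson.mk φ) : unitary (Matrix (Fin m) (Fin m) (Leavitt r))) :
            Matrix (Fin m) (Fin m) (Leavitt r)) =
          ∑ a : φ.dom, BHTWord.toMatrix (fun _ => Leavitt.y) (a : BHTWord r m 1) *
            star (BHTWord.toMatrix (fun _ => Leavitt.y) (φ.map a : BHTWord r m 1))) :=
  ⟨LeavittTensor.isPositiveLeavittFamily.exists_mulEquiv,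
    Leavitt.isPositiveLeavittFamily.exists_mulEquiv⟩
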